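/- Setting. Let $K\ge 1$ and let $\theta=(\theta_1,\dots,\theta_K)'\sim\mathcal N(\mu^0,V^0)$ with $V^0$ positive definite. There are $K$ sources; an observation of source $k$ is $X_k=\langle c_k,\theta\rangle+\epsilon_k$ with $\epsilon_k\sim\mathcal N(0,\sigma_k^2)$, $\sigma_k>0$, where the matrix $C$ with rows $c_k'$ is invertible and all error terms are independent of each other (across realizations and sources) and of $\theta$. In each period $t=1,2,\dots$ a decision maker (DM) chooses $B$ sources (repetition allowed), as a measurable function of the signal realizations of the earlier periods (an information acquisition strategy), observes the realizations, and then takes an action $a_t\in A_t$, as a measurable function of all realizations observed so far (a decision strategy). The payoff is $U(a_1,a_2,\dots;\theta_1)$, where the measurable spaces $A_t$ and the measurable real-valued function $U$ are arbitrary. Let $f(q_1,\dots,q_K)$ be the posterior variance of $\theta_1$ after $q_k$ observations of each source $k$. An acquisition strategy is myopic if at every history the $B$ sources it chooses, combined with the past observations, give the lowest posterior variance of $\theta_1$. A vector $n(t)=(n_1(t),\dots,n_K(t))$ is $t$-optimal if it minimizes $f$ over all vectors of nonnegative integers with sum $t$. Put $\tilde\theta_k=\frac1{\sigma_k}\langle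 c_k,\theta\rangle$, let $\tilde V$ be the covariance matrix of $(\tilde\theta_1,\dots,\tilde\theta_K)$, and let $R$ be the Euclidean operator norm of $\tilde V^{-1}$. Proposition. Suppose that $\theta_1=\tilde\theta_1+\dots+\tilde\theta_K$, i.e. all payoff weights on the transformed states are $1$. (a) If $B\ge 8(R+1)K^{1.5}$, then myopic information acquisition is optimal: there is a myopic acquisition strategy $S^*$ such that, for every choice of the action sets $A_t$ and the payoff function $U$, and for every acquisition strategy $S$ and decision strategy $A$ with finite expected payoff, there is a decision strategy $A^*$ such that the expected payoff of $(S^*,A^*)$ is finite and at least that of $(S,A)$. In particular, whenever the DM has an optimal strategy (among strategies with finite expected payoff), he has one that acquires information by $S^*$, hence myopically. (b) For every $t\ge 8(R+1)K\sqrt K$, every $t$-optimal vector $n(t)$ and every $i$, $$\left|n_i(t)-\frac tK\right|\le 4(R+1)\sqrt K .$$ -/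

import Mathlib

open MeasureTheory ProbabilityTheory
open scoped BigOperators

universe u

noncomputable section

namespace Acquisition

/-- An informational environment with `K` states and `K` sources.  The state vector is Gaussian with
mean `mean` and positive definite covariance matrix `V`; source `k` has coefficient vector `C k`
(the `k`-th row of an invertible matrix) and noise standard deviation `σ k > 0`.
The payoff-relevant state is the coordinate `0`. -/
structure Environment (K : ℕ) where
  mean : EuclideanSpace ℝ (Fin K)
  V : Matrix (Fin K) (Fin K) ℝ
  C : Matrix (Fin K) (Fin K) ℝ
  σ : Fin K → ℝ
  V_posDef : V.PosDef
  C_invertible : IsUnit C.det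
  σ_pos : ∀ k, 0 < σ k

/-- A sample point: the state vector, and for each pair `(n, k)` the (standardized) noise in the
`n`-th potential realization of source `k`. -/
abbrev Sample (K : ℕ) : Type := EuclideanSpace ℝ (Fin K) × (ℕ × Fin K → ℝ)

/-- `History B t`: the realizations observed in the first `t` periods, `B` per period. -/
abbrev History (B t : ℕ) : Type := Fin t → Fin B → ℝ

/-- An information acquisition strategy: at each period, a measurable map from the past signal
realizations to the `B` sources observed in that period, repetition allowed.  A multi-set of `B`
sources is given by a listing of it. -/
structure InfoStrategy (K B : ℕ) where
  choose : (t : ℕ) → History B t → (Fin B → Fin K)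
  measurable_choose : ∀ t, Measurable (choose t)

/-- Number of times each source occurs in a choice of `B` sources. -/
def tally {K B : ℕ} (c : Fin B → Fin K) (k : Fin K) : ℕ :=
  (Finset.univ.filter fun b => c b = k).card

/-- The division vector after the history `h` under `S`: how often each source was observed. -/
def InfoStrategy.division {K B : ℕ} (S : InfoStrategy K B) {t : ℕ} (h : History B t) : Fin K → ℕ :=
  ∑ s : Fin t, tally (S.choose s fun r : Fin s => h (Fin.castLE s.isLt.le r))

/-- A decision problem: action sets `Act t` for the periods `t = 0, 1, …`, and a payoff that is an
arbitrary (measurable) function of the whole action sequence and the payoff-relevant state. -/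
structure DecisionProblem where
  Act : ℕ → Type u
  measAct : ∀ t, MeasurableSpace (Act t)
  U : ((t : ℕ) → Act t) → ℝ → ℝ
  measurable_U : Measurable fun p : ((t : ℕ) → Act t) × ℝ => U p.1 p.2

attribute [instance] DecisionProblem.measAct

/-- A decision strategy: the action of each period as a measurable function of the realizations
observed up to and including that period. -/
structure DecisionStrategy (D : DecisionProblem.{u}) (B : ℕ) where
  act : (t : ℕ) → History B (t + 1) → D.Act t
  measurable_act : ∀ t, Measurable (act t)

namespace Environment

variable {K : ℕ}

/-- The probability measure on sample points: the states have law `N(mean, V)`, all noise terms are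
standard normal, and everything is independent. -/
def P (E : Environment K) : Measure (Sample K) :=
  (multivariateGaussian E.mean E.V).prod (Measure.infinitePi fun _ : ℕ × Fin K => gaussianReal 0 1)

/-- The `n`-th realization of source `k`: `⟨c_k, θ⟩` plus noise with variance `σ_k ^ 2`. -/
def signal (E : Environment K) (n : ℕ) (k : Fin K) (ω : Sample K) : ℝ :=
  (∑ j, E.C k j * ω.1 j) + E.σ k * ω.2 (n, k)

/-- The transformed state `⟨c_k, θ⟩ / σ_k`. -/
def transformedState (E : Environment K) (k : Fin K) (θ : EuclideanSpace ℝ (Fin K)) : ℝ :=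
  (1 / E.σ k) * ∑ j, E.C k j * θ j

/-- The prior covariance matrix of the transformed states. -/
def transformedCov (E : Environment K) : Matrix (Fin K) (Fin K) ℝ :=
  Matrix.of fun i j =>
    cov[E.transformedState i, E.transformedState j; multivariateGaussian E.mean E.V]

/-- The Euclidean operator norm of the inverse of the prior covariance of the transformed states. -/
def R (E : Environment K) : ℝ :=
  ‖Matrix.toEuclideanCLM (n := Fin K) (𝕜 := ℝ) (E.transformedCov)⁻¹‖

/-- The information contained in `q k` realizations of each source `k`. -/
abbrev observed (E : Environment K) (q : Fin K → ℕ) : MeasurableSpace (Sample K) :=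
  MeasurableSpace.comap
    (fun (ω : Sample K) (p : (k : Fin K) × Fin (q k)) => E.signal p.2 p.1 ω) inferInstance

/-- The posterior variance of the payoff-relevant state after `q k` observations of each source `k`.
In this Gaussian model the conditional variance is almost surely constant, so that its
expectation is its value. -/
def postVar [NeZero K] (E : Environment K) (q : Fin K → ℕ) : ℝ :=
  ∫ ω, (Var[fun ω' : Sample K => ω'.1 0; E.P | E.observed q]) ω ∂E.P

/-- `n` is a `t`-optimal division vector: it minimizes the posterior variance of the payoff-relevant
state among all allocations of `t` observations to the sources. -/
def IsOptimalDivision [NeZero K] (E : Environment K) (t : ℕ) (n : Fin K → ℕ) : Prop :=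
  ∑ k, n k = t ∧ ∀ q : Fin K → ℕ, ∑ k, q k = t → E.postVar n ≤ E.postVar q

/-- The myopic property: at every history the `B` chosen sources, combined with the past
observations, lead to the lowest posterior variance of the payoff-relevant state. -/
def IsMyopic [NeZero K] (E : Environment K) {B : ℕ} (S : InfoStrategy K B) : Prop :=
  ∀ (t : ℕ) (h : History B t) (c : Fin B → Fin K),
    E.postVar (S.division h + tally (S.choose t h)) ≤ E.postVar (S.division h + tally c)

/-- The history of the first `t` periods that arises at the sample point `ω` under `S`.  Slot `b` of
period `t` shows realization number `t * B + b` of the source chosen there, so that no two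
observations share a noise term. -/
def hist (E : Environment K) {B : ℕ} (S : InfoStrategy K B) (ω : Sample K) :
    (t : ℕ) → History B t
  | 0 => Fin.elim0
  | t + 1 => Fin.snoc (α := fun _ => Fin B → ℝ) (E.hist S ω t) fun b =>
      E.signal (t * B + b) (S.choose t (E.hist S ω t) b) ω

/-- The realized payoff. -/
def payoff [NeZero K] (E : Environment K) {B : ℕ} (D : DecisionProblem.{u})
    (S : InfoStrategy K B) (A : DecisionStrategy D B) (ω : Sample K) : ℝ :=
  D.U (fun t => A.act t (E.hist S ω (t + 1))) (ω.1 0)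

/-- The strategy `(S, A)` has a finite expected payoff. -/
def FinitePayoff [NeZero K] (E : Environment K) {B : ℕ} (D : DecisionProblem.{u})
    (S : InfoStrategy K B) (A : DecisionStrategy D B) : Prop :=
  Integrable (E.payoff D S A) E.P

/-- The expected payoff of `(S, A)`. -/
def expectedPayoff [NeZero K] (E : Environment K) {B : ℕ} (D : DecisionProblem.{u})
    (S : InfoStrategy K B) (A : DecisionStrategy D B) : ℝ :=
  ∫ ω, E.payoff D S A ω ∂E.P

/-- `(S, A)` is optimal among all strategies with finite expected payoff. -/
def IsOptimal [NeZero K] (E : Environment K) {B : ℕ} (D : DecisionProblem.{u})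
    (S : InfoStrategy K B) (A : DecisionStrategy D B) : Prop :=
  E.FinitePayoff D S A ∧ ∀ (S' : InfoStrategy K B) (A' : DecisionStrategy D B),
    E.FinitePayoff D S' A' → E.expectedPayoff D S' A' ≤ E.expectedPayoff D S A

/-- Immediate optimality of myopic acquisition with `B` observations per period.  There is a myopic
acquisition strategy such that in every decision problem each strategy is matched or improved by
one that acquires information by it; in particular, when the problem has an optimal strategy at all,
it has an optimal one that acquires information myopically. -/
def MyopicIsOptimal [NeZero K] (E : Environment K) (B : ℕ) : Prop :=
  ∃ S : InfoStrategy K B, E.IsMyopic S ∧ ∀ D : DecisionProblem.{u},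
    (∀ (S' : InfoStrategy K B) (A' : DecisionStrategy D B), E.FinitePayoff D S' A' →
      ∃ A : DecisionStrategy D B, E.FinitePayoff D S A ∧
        E.expectedPayoff D S' A' ≤ E.expectedPayoff D S A) ∧
    ((∃ (S' : InfoStrategy K B) (A' : DecisionStrategy D B), E.IsOptimal D S' A') →
      ∃ A : DecisionStrategy D B, E.IsOptimal D S A)

end Environment

end Acquisition

end

/-! Divided by `σ k`, source `k` reports the transformed state `k` with unit noise. With `A` the
inverse of `transformedCov`, `q` observations therefore give the posterior precision `A + diag q`,
and since all payoff weights are 1 the posterior variance of `θ 0` is `1ᵀ (A + diag q)⁻¹ 1`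
(`postVar_eq_stateVar`).

Part (b). The real-valued division `c - (A 1)_k`, with `c` fixed by the total `t`, makes every row
sum of the precision matrix equal to `c`, and its variance is `K / c`. By `precVar_eq_add` the
excess of any other division over `K / c` is exactly a quadratic form in its deviation `δ`. Rounding
the real division bounds the excess of an optimal one, Cauchy–Schwarz in the precision form turns
this into `|δ i| ≤ 2√K`, and the real division itself is within `R + R√K` of `t / K`.

Part (a). Optimal divisions for `t * B` and `(t + 1) * B` observations each lie within `4(R+1)√K` of
the even split, while the even split grows by `B / K ≥ 8(R+1)√K`. Hence optimal divisions are
increasing in `t`, and a history-independent strategy follows them. It is myopic, and at every date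
its posterior variance `v t` is the smallest attainable by any strategy.

It remains to see that smaller variances at all dates suffice in every decision problem, which is
the content of `exists_simulation`. Under the fixed strategy the posterior mean moves by independent
normal increments of variance `v t - v (t + 1)`. For an arbitrary strategy `S`, blurring its
posterior mean by independent normal noise of variance (its posterior variance) `- v t` produces a
statistic with the same relation to the state. Reading the actual posterior mean as this statistic,
one draws the realizations of `S` period by period from their conditional law, without looking
ahead. The simulated histories and the state then have the same joint law as under `S`, so every
decision strategy for `S` can be imitated. The randomization is removed by fixing a seed that does
at least as well as the average (`exists_payoff_ge_of_simulation`). -/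

noncomputable section

namespace Acquisition

open Matrix

/-! ### Posterior variance as a function of the precision matrix -/

section Precision

variable {K : ℕ} {A : Matrix (Fin K) (Fin K) ℝ}

/-- The posterior precision matrix after `q k` unit-noise observations of each state `k`, for the
prior precision matrix `A`. -/
def precision (A : Matrix (Fin K) (Fin K) ℝ) (q : Fin K → ℕ) : Matrix (Fin K) (Fin K) ℝ :=
  A + diagonal fun k => (q k : ℝ)

/-- The posterior covariances of the states with their sum. -/
def precWeight (A : Matrix (Fin K) (Fin K) ℝ) (q : Fin K → ℕ) : Fin K → ℝ :=
  (precision A q)⁻¹ *ᵥ 1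

/-- The posterior variance of the sum of the states. -/
def precVar (A : Matrix (Fin K) (Fin K) ℝ) (q : Fin K → ℕ) : ℝ :=
  ∑ k, precWeight A q k

lemma precision_posDef (hA : A.PosDef) (q : Fin K → ℕ) : (precision A q).PosDef :=
  hA.add_posSemidef (PosSemidef.diagonal fun k => Nat.cast_nonneg (q k))

lemma precision_mulVec_inv_mulVec (hA : A.PosDef) (q : Fin K → ℕ) (x : Fin K → ℝ) :
    precision A q *ᵥ ((precision A q)⁻¹ *ᵥ x) = x := by
  have h := (precision_posDef hA q).isUnit
  rw [isUnit_iff_isUnit_det] at h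
  rw [mulVec_mulVec, mul_nonsing_inv _ h, one_mulVec]

lemma precision_mulVec_precWeight (hA : A.PosDef) (q : Fin K → ℕ) :
    precision A q *ᵥ precWeight A q = 1 :=
  precision_mulVec_inv_mulVec hA q 1

lemma precision_mulVec_apply (q : Fin K → ℕ) (x : Fin K → ℝ) (k : Fin K) :
    (precision A q *ᵥ x) k = (A *ᵥ x) k + q k * x k := by
  simp [precision, add_mulVec, mulVec_diagonal]

lemma dotProduct_mulVec_symm (hA : A.IsHermitian) (x y : Fin K → ℝ) :
    x ⬝ᵥ A *ᵥ y = y ⬝ᵥ A *ᵥ x := by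
  have h : Aᵀ = A := by simpa [IsHermitian, conjTranspose_eq_transpose_of_trivial] using hA
  rw [dotProduct_mulVec, ← mulVec_transpose, h, dotProduct_comm]

/-- The excess of the posterior variance over its value at the real-valued division that equalizes
the posterior covariances is a quadratic form in the distance `δ` from that division. -/
lemma precVar_eq_add (hA : A.PosDef) (n : Fin K → ℕ) {c : ℝ} (hc : c ≠ 0) {δ : Fin K → ℝ}
    (h : precision A n *ᵥ 1 = c • 1 + δ) (hδ : ∑ k, δ k = 0) :
    precVar A n = K / c + (δ ⬝ᵥ (precision A n)⁻¹ *ᵥ δ) / c ^ 2 := by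
  set u := (precision A n)⁻¹ *ᵥ δ with hu
  have hPu : precision A n *ᵥ u = δ := precision_mulVec_inv_mulVec hA n δ
  -- Applying the inverse precision to `h` splits the vector 1. Summing this identity, and pairing
  -- it with `δ`, which is orthogonal to 1, gives two linear equations that determine the variance.
  have hone : (1 : Fin K → ℝ) = c • precWeight A n + u := by
    have h' := congrArg (fun x => (precision A n)⁻¹ *ᵥ x) h
    have hunit := (precision_posDef hA n).isUnit
    rw [isUnit_iff_isUnit_det] at hunit
    simp only [mulVec_mulVec, nonsing_inv_mul _ hunit, one_mulVec, mulVec_add, mulVec_smul] at h'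
    exact h'
  have hsum : (K : ℝ) = c * precVar A n + ∑ k, u k := by
    have := congrArg (fun x : Fin K → ℝ => ∑ k, x k) hone
    simpa [precVar, Finset.sum_add_distrib, Finset.mul_sum] using this
  have hw : precWeight A n ⬝ᵥ δ = ∑ k, u k := by
    rw [← hPu, dotProduct_mulVec_symm (precision_posDef hA n).isHermitian,
      precision_mulVec_precWeight hA]
    simp [dotProduct]
  have hwu : c * (precWeight A n ⬝ᵥ δ) + u ⬝ᵥ δ = 0 := by
    rw [← smul_eq_mul, ← smul_dotProduct, ← add_dotProduct, ← hone]
    simp [dotProduct, hδ]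
  rw [dotProduct_comm δ u]
  have hu' : u ⬝ᵥ δ = -(c * ∑ k, u k) := by rw [← hw]; linarith
  rw [hu', show (∑ k, u k) = K - c * precVar A n by linarith]
  field_simp
  ring

/-- The precision matrix dominates `diag n`, and inversion reverses the order. Concretely, a square
is completed in each coordinate and the term in `A` is dropped. -/
lemma dotProduct_inv_mulVec_le (hA : A.PosDef) {n : Fin K → ℕ} (hn : ∀ k, 0 < n k)
    (δ : Fin K → ℝ) :
    δ ⬝ᵥ (precision A n)⁻¹ *ᵥ δ ≤ ∑ k, δ k ^ 2 / n k := by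
  set u := (precision A n)⁻¹ *ᵥ δ with hu
  have hPu : precision A n *ᵥ u = δ := precision_mulVec_inv_mulVec hA n δ
  have hAu : 0 ≤ u ⬝ᵥ A *ᵥ u := by simpa using hA.posSemidef.dotProduct_mulVec_nonneg u
  have h1 : δ ⬝ᵥ u = u ⬝ᵥ A *ᵥ u + ∑ k, n k * u k ^ 2 := by
    nth_rw 1 [← hPu]
    rw [dotProduct_comm]
    simp only [dotProduct, precision_mulVec_apply]
    rw [← Finset.sum_add_distrib]
    exact Finset.sum_congr rfl fun k _ => by ring
  have h2 : 2 * (δ ⬝ᵥ u) ≤ ∑ k, δ k ^ 2 / n k + ∑ k, n k * u k ^ 2 := by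
    rw [dotProduct, Finset.mul_sum, ← Finset.sum_add_distrib]
    refine Finset.sum_le_sum fun k _ => ?_
    have hk : (0 : ℝ) < n k := Nat.cast_pos.2 (hn k)
    have : 0 ≤ (δ k - n k * u k) ^ 2 / n k := by positivity
    have e : (δ k - n k * u k) ^ 2 / n k = δ k ^ 2 / n k + n k * u k ^ 2 - 2 * (δ k * u k) := by
      field_simp
      ring
    linarith
  linarith

/-- Cauchy–Schwarz for the form of the precision matrix `P`, applied to `e_i` and `u = P⁻¹ δ`: their
product is `δ i`, and `u` has square norm `δᵀ P⁻¹ δ`. -/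
lemma le_dotProduct_inv_mulVec (hA : A.PosDef) (n : Fin K → ℕ) (δ : Fin K → ℝ) (i : Fin K) :
    δ i ^ 2 ≤ (A i i + n i) * (δ ⬝ᵥ (precision A n)⁻¹ *ᵥ δ) := by
  set u := (precision A n)⁻¹ *ᵥ δ with hu
  have hPu : precision A n *ᵥ u = δ := precision_mulVec_inv_mulVec hA n δ
  have hP := precision_posDef hA n
  set p := A i i + n i with hp
  have hpp : precision A n i i = p := by simp [precision, hp]
  have hpos : 0 < p := hpp ▸ (hP.diag_pos (i := i))
  -- The coefficient of the projection of `u` on `e_i` in this form.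
  set y := δ i / p with hy
  have h0 : 0 ≤ (u - y • Pi.single i 1) ⬝ᵥ precision A n *ᵥ (u - y • Pi.single i 1) := by
    exact hP.posSemidef.dotProduct_mulVec_nonneg (u - y • Pi.single i (1 : ℝ))
  have hs : u ⬝ᵥ precision A n *ᵥ Pi.single i 1 = δ i := by
    rw [dotProduct_mulVec_symm hP.isHermitian, hPu]
    simp
  have hss : Pi.single i 1 ⬝ᵥ precision A n *ᵥ Pi.single i 1 = p := by
    simp [hpp]
  have hsu : Pi.single i 1 ⬝ᵥ precision A n *ᵥ u = δ i := by simp [hPu]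
  rw [mulVec_sub, mulVec_smul, sub_dotProduct, dotProduct_sub, dotProduct_sub] at h0
  simp only [smul_dotProduct, dotProduct_smul, smul_eq_mul, hs, hss, hsu] at h0
  rw [hPu, dotProduct_comm u δ] at h0
  have hyp : y * p = δ i := by rw [hy]; field_simp
  have h1 : 0 ≤ p * (δ ⬝ᵥ u - y * δ i - (y * δ i - y * (y * p))) := by positivity
  nlinarith

end Precision

/-! ### Entries and row sums bounded by the operator norm -/

section OperatorNorm

variable {K : ℕ} (A : Matrix (Fin K) (Fin K) ℝ)

lemma abs_dotProduct_mulVec_le (x y : Fin K → ℝ) :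
    |x ⬝ᵥ A *ᵥ y| ≤ ‖toEuclideanCLM (n := Fin K) (𝕜 := ℝ) A‖ * (√(x ⬝ᵥ x) * √(y ⬝ᵥ y)) := by
  have hn : ∀ z : Fin K → ℝ, ‖WithLp.toLp 2 z‖ = √(z ⬝ᵥ z) := fun z => by
    simp [EuclideanSpace.norm_eq, dotProduct, sq]
  have h : x ⬝ᵥ A *ᵥ y =
      inner ℝ (WithLp.toLp 2 x) (toEuclideanCLM (n := Fin K) (𝕜 := ℝ) A (WithLp.toLp 2 y)) := by
    simp [toEuclideanCLM_toLp, EuclideanSpace.inner_toLp_toLp, dotProduct_comm]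
  rw [h, ← hn, ← hn]
  refine (abs_real_inner_le_norm _ _).trans ?_
  calc ‖WithLp.toLp 2 x‖ * ‖toEuclideanCLM (n := Fin K) (𝕜 := ℝ) A (WithLp.toLp 2 y)‖
      ≤ ‖WithLp.toLp 2 x‖ * (‖toEuclideanCLM (n := Fin K) (𝕜 := ℝ) A‖ * ‖WithLp.toLp 2 y‖) := by
        gcongr
        exact ContinuousLinearMap.le_opNorm _ _
    _ = _ := by ring

lemma abs_mulVec_one_le (i : Fin K) :
    |(A *ᵥ 1) i| ≤ ‖toEuclideanCLM (n := Fin K) (𝕜 := ℝ) A‖ * √(K : ℝ) := by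
  simpa using abs_dotProduct_mulVec_le A (Pi.single i 1) 1

lemma abs_diag_le (i : Fin K) : |A i i| ≤ ‖toEuclideanCLM (n := Fin K) (𝕜 := ℝ) A‖ := by
  simpa using abs_dotProduct_mulVec_le A (Pi.single i 1) (Pi.single i 1)

lemma abs_sum_mulVec_one_le :
    |∑ i, (A *ᵥ 1) i| ≤ ‖toEuclideanCLM (n := Fin K) (𝕜 := ℝ) A‖ * K := by
  have h := abs_dotProduct_mulVec_le A 1 1
  simpa [one_dotProduct] using h

end OperatorNorm

/-! ### Rounding with the sum preserved -/

section Rounding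

variable {K : ℕ}

/-- Nonnegative reals with integral sum can be rounded to naturals with the same sum. -/
lemma exists_rounding (x : Fin K → ℝ) (hx : ∀ k, 0 ≤ x k) (t : ℕ) (ht : ∑ k, x k = t) :
    ∃ m : Fin K → ℕ, ∑ k, m k = t ∧ ∀ k, |(m k : ℝ) - x k| ≤ 1 := by
  have h1 : ∑ k, ⌊x k⌋₊ ≤ t := by
    have : ∑ k, (⌊x k⌋₊ : ℝ) ≤ t := ht ▸ Finset.sum_le_sum fun k _ => Nat.floor_le (hx k)
    exact_mod_cast this
  have h2 : t ≤ ∑ k, ⌊x k⌋₊ + K := by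
    have : (t : ℝ) ≤ ∑ k, ((⌊x k⌋₊ : ℝ) + 1) :=
      ht ▸ Finset.sum_le_sum fun k _ => (Nat.lt_floor_add_one _).le
    rw [Finset.sum_add_distrib] at this
    simp only [Finset.sum_const, Finset.card_univ, Fintype.card_fin, nsmul_eq_mul, mul_one] at this
    exact_mod_cast this
  -- Rounding everything down loses at most `K` units in total; they are returned to that many
  -- distinct coordinates.
  obtain ⟨s, -, hs⟩ := Finset.exists_subset_card_eq (s := (Finset.univ : Finset (Fin K)))
    (n := t - ∑ k, ⌊x k⌋₊) (by simp; omega)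
  refine ⟨fun k => ⌊x k⌋₊ + if k ∈ s then 1 else 0, ?_, fun k => ?_⟩
  · rw [Finset.sum_add_distrib]
    simp [hs]
    omega
  · have a := Nat.floor_le (hx k)
    have b := (Nat.lt_floor_add_one (x k)).le
    rw [abs_le]
    dsimp only
    split_ifs <;> push_cast <;> constructor <;> linarith

end Rounding

/-! ### Optimal divisions are nearly equal -/

section Division

/-- Since `24 R s ≤ 3 T` and `8 s ≤ T`, the hypothesis reduces to `7 x² ≤ 11 s² + x s`, which fails
for `x > 2 s`, where even `7 x² - x s - 26 s² = (x - 2 s)(7 x + 13 s)` is positive. -/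
lemma le_two_mul_of_quadratic {s R T x : ℝ} (hs : 1 ≤ s) (hR : 0 ≤ R)
    (hT : 8 * (R + 1) * s ≤ T) (hx : 0 ≤ x)
    (hq : 7 * T * x ^ 2 ≤ 8 * (T + 3 * (R * s) + x) * (s * s)) : x ≤ 2 * s := by
  by_contra hcon
  push Not at hcon
  have hRs : 0 ≤ R * s := by positivity
  have hsT : 8 * s ≤ T := by linarith
  have hTpos : 0 < T := by linarith
  have h4 : 8 * (T + 3 * (R * s) + x) * (s * s) ≤ (11 * T + 8 * x) * (s * s) := by
    refine mul_le_mul_of_nonneg_right ?_ (mul_self_nonneg s)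
    linarith
  have h5 : 0 ≤ (T - 8 * s) * (x * s) :=
    mul_nonneg (by linarith) (mul_nonneg hx (by linarith))
  have h6 : T * (7 * x ^ 2) ≤ T * (11 * (s * s) + x * s) := by linarith
  have h7 := le_of_mul_le_mul_left h6 hTpos
  have h8 : 0 < (x - 2 * s) * (7 * x + 13 * s) := mul_pos (by linarith) (by linarith)
  nlinarith

variable {K : ℕ} [NeZero K] {A : Matrix (Fin K) (Fin K) ℝ}

lemma abs_sub_le_of_isMin (hA : A.PosDef) {t : ℕ} {n : Fin K → ℕ} (hn : ∑ k, n k = t)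
    (hmin : ∀ q : Fin K → ℕ, ∑ k, q k = t → precVar A n ≤ precVar A q)
    (ht : 8 * (‖toEuclideanCLM (n := Fin K) (𝕜 := ℝ) A‖ + 1) * K * √(K : ℝ) ≤ t) (i : Fin K) :
    |(n i : ℝ) - t / K| ≤ 4 * (‖toEuclideanCLM (n := Fin K) (𝕜 := ℝ) A‖ + 1) * √(K : ℝ) := by
  set R := ‖toEuclideanCLM (n := Fin K) (𝕜 := ℝ) A‖ with hR
  have hR0 : 0 ≤ R := norm_nonneg _
  have hK1 : (1 : ℝ) ≤ K := by exact_mod_cast NeZero.one_le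
  set s := √(K : ℝ) with hs
  have hs1 : 1 ≤ s := by rw [hs]; exact Real.one_le_sqrt.2 hK1
  have hss : s * s = K := Real.mul_self_sqrt (by positivity)
  set T : ℝ := t / K with hT
  have hTK : T * K = t := by rw [hT]; field_simp
  have hT8 : 8 * (R + 1) * s ≤ T := by
    rw [hT, le_div_iff₀ (by positivity)]
    linarith
  set S := ∑ k, (A *ᵥ 1) k with hS
  have hS0 : 0 ≤ S := by
    have := hA.posSemidef.dotProduct_mulVec_nonneg (1 : Fin K → ℝ)
    simpa [one_dotProduct] using this
  have hSle : S ≤ R * K := (le_abs_self _).trans (abs_sum_mulVec_one_le A)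
  -- The common row sum for which the entries `c - (A 1)_k` add up to `t`.
  set c := T + S / K with hc
  have hcT : T ≤ c := by
    have : 0 ≤ S / K := by positivity
    linarith
  have hcR : c ≤ T + R := by
    have : S / K ≤ R := by rw [div_le_iff₀ (by positivity)]; exact hSle
    linarith
  have hRs : 0 ≤ R * s := by positivity
  have hRRs : R ≤ R * s := le_mul_of_one_le_right hR0 hs1
  have hTpos : 0 < T := by nlinarith
  have hcpos : 0 < c := by linarith
  have hAk : ∀ k, |(A *ᵥ 1) k| ≤ R * s := abs_mulVec_one_le A
  have hAi : A i i ≤ R := (le_abs_self _).trans (abs_diag_le A i)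
  have hcK : c * K = t + S := by rw [hc, add_mul, hTK]; field_simp
  -- the excess formula
  have key : ∀ m : Fin K → ℕ, ∑ k, m k = t → ∀ δ : Fin K → ℝ,
      (δ = fun k => (m k : ℝ) - (c - (A *ᵥ 1) k)) →
      precVar A m = K / c + (δ ⬝ᵥ (precision A m)⁻¹ *ᵥ δ) / c ^ 2 := by
    rintro m hm δ rfl
    refine precVar_eq_add hA m hcpos.ne' ?_ ?_
    · ext k
      simp [precision_mulVec_apply]
      ring
    · simp only [Finset.sum_sub_distrib, Finset.sum_const, Finset.card_univ, Fintype.card_fin,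
        nsmul_eq_mul]
      have : ∑ k, (m k : ℝ) = t := by exact_mod_cast hm
      rw [this, ← hS]
      linarith
  obtain ⟨m, hmt, hmr⟩ := exists_rounding (fun k => c - (A *ᵥ 1) k)
    (fun k => by have := (abs_le.1 (hAk k)).2; nlinarith) t (by
      simp only [Finset.sum_sub_distrib, Finset.sum_const, Finset.card_univ, Fintype.card_fin,
        nsmul_eq_mul]
      rw [← hS]; linarith)
  set r : Fin K → ℝ := fun k => (m k : ℝ) - (c - (A *ᵥ 1) k) with hr
  set δ : Fin K → ℝ := fun k => (n k : ℝ) - (c - (A *ᵥ 1) k) with hδ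
  -- The loss relative to `T` is at most `R s + 1 ≤ (R + 1) s ≤ T / 8`.
  have hm78 : ∀ k, 7 / 8 * T ≤ m k := fun k => by
    have h1 := (abs_le.1 (hmr k)).1
    have h2 := (abs_le.1 (hAk k)).2
    nlinarith
  have hmpos : ∀ k, 0 < m k := fun k => by
    have : (0 : ℝ) < m k := lt_of_lt_of_le (by positivity) (hm78 k)
    exact_mod_cast this
  -- By optimality the excess of `n` is at most that of the rounded division `m`, whose deviations
  -- are at most 1.
  have hupper : δ ⬝ᵥ (precision A n)⁻¹ *ᵥ δ ≤ K * (8 / (7 * T)) := by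
    have h1 : δ ⬝ᵥ (precision A n)⁻¹ *ᵥ δ ≤ r ⬝ᵥ (precision A m)⁻¹ *ᵥ r := by
      have := hmin m hmt
      rw [key n hn δ rfl, key m hmt r rfl] at this
      have h2 : (δ ⬝ᵥ (precision A n)⁻¹ *ᵥ δ) / c ^ 2 ≤ (r ⬝ᵥ (precision A m)⁻¹ *ᵥ r) / c ^ 2 := by
        linarith
      exact (div_le_div_iff_of_pos_right (by positivity)).1 h2
    refine h1.trans ((dotProduct_inv_mulVec_le hA hmpos r).trans ?_)
    calc ∑ k, r k ^ 2 / m k ≤ ∑ _k : Fin K, 8 / (7 * T) := by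
          refine Finset.sum_le_sum fun k _ => ?_
          have h2 : r k ^ 2 ≤ 1 := by rw [← sq_abs]; exact pow_le_one₀ (abs_nonneg _) (hmr k)
          calc r k ^ 2 / m k ≤ 1 / (7 / 8 * T) :=
                div_le_div₀ zero_le_one h2 (by positivity) (hm78 k)
            _ = 8 / (7 * T) := by field_simp
      _ = K * (8 / (7 * T)) := by simp
  have hlow := le_dotProduct_inv_mulVec hA n δ i
  set x := |δ i| with hx
  have hx0 : 0 ≤ x := abs_nonneg _
  have hni : (n i : ℝ) ≤ T + R + R * s + x := by
    have h1 := (abs_le.1 (hAk i)).1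
    have h2 : δ i ≤ x := le_abs_self _
    have h3 : (n i : ℝ) = δ i + (c - (A *ᵥ 1) i) := by simp [hδ]
    linarith
  -- The unknown deviation also enters on the right, because `n i` itself is bounded only through
  -- `x`.
  have hq : x ^ 2 ≤ (T + 3 * (R * s) + x) * (K * (8 / (7 * T))) := by
    rw [hx, sq_abs, ← hx]
    refine hlow.trans ?_
    have h1 : 0 ≤ K * (8 / (7 * T)) := by positivity
    have h2 : 0 < A i i := hA.diag_pos
    have h3 : A i i + n i ≤ T + 3 * (R * s) + x := by linarith
    exact (mul_le_mul_of_nonneg_left hupper (by positivity)).trans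
      (mul_le_mul_of_nonneg_right h3 h1)
  have hq' : 7 * T * x ^ 2 ≤ 8 * (T + 3 * (R * s) + x) * (s * s) := by
    have : (T + 3 * (R * s) + x) * (K * (8 / (7 * T))) =
        8 * (T + 3 * (R * s) + x) * (s * s) / (7 * T) := by
      rw [hss]; field_simp
    rw [this, le_div_iff₀ (by positivity)] at hq
    linarith
  have hx2 : x ≤ 2 * s := le_two_mul_of_quadratic hs1 hR0 hT8 hx0 hq'
  have hfin : (n i : ℝ) - T = δ i + (c - T) - (A *ᵥ 1) i := by simp [hδ]; ring
  rw [hfin, abs_le]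
  have h1 := abs_le.1 (hAk i)
  have h2 := abs_le.1 (le_refl |δ i|)
  rw [← hx] at h2
  constructor <;> linarith [h1.1, h1.2, h2.1, h2.2]

end Division

/-! ### The states and noise terms as one Gaussian family -/

namespace Environment

variable {K : ℕ} (E : Environment K)

instance : IsProbabilityMeasure E.P := by
  unfold P
  infer_instance

@[fun_prop]
lemma measurable_transformedState (k : Fin K) : Measurable (E.transformedState k) := by
  unfold transformedState
  fun_prop

@[fun_prop]
lemma measurable_signal (n : ℕ) (k : Fin K) : Measurable (E.signal n k) := by
  unfold signal
  fun_prop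

/-- The transformed state as a continuous linear functional. -/
def stateCLM (k : Fin K) : EuclideanSpace ℝ (Fin K) →L[ℝ] ℝ :=
  (1 / E.σ k) • ∑ j, E.C k j • EuclideanSpace.proj (𝕜 := ℝ) j

lemma stateCLM_apply (k : Fin K) (θ : EuclideanSpace ℝ (Fin K)) :
    E.stateCLM k θ = E.transformedState k θ := by
  simp [stateCLM, transformedState]

/-- The covariance is a congruence of `V` by the invertible matrix `diag (1 / σ) * C`. -/
lemma transformedCov_posDef : E.transformedCov.PosDef := by
  set D : Matrix (Fin K) (Fin K) ℝ := diagonal fun k => 1 / E.σ k with hD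
  have hσ : ∀ k, E.σ k ≠ 0 := fun k => (E.σ_pos k).ne'
  have hmem : ∀ j, MemLp (fun θ : EuclideanSpace ℝ (Fin K) => θ j) 2
      (multivariateGaussian E.mean E.V) := fun j =>
    IsGaussian.memLp_dual _ (EuclideanSpace.proj (𝕜 := ℝ) j) 2 (by simp)
  have h : E.transformedCov = (D * E.C) * E.V * (D * E.C)ᴴ := by
    ext i k
    have e1 : ∀ i : Fin K, E.transformedState i =
        fun θ => ∑ j, (D * E.C) i j * θ j := fun i => by
      ext θ
      simp [transformedState, hD, diagonal_mul, Finset.mul_sum, mul_assoc]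
    rw [transformedCov, of_apply, e1, e1, covariance_fun_sum_fun_sum
      (fun j => (hmem j).const_mul _) (fun j => (hmem j).const_mul _)]
    simp_rw [covariance_const_mul_left, covariance_const_mul_right,
      covariance_eval_multivariateGaussian E.V_posDef.posSemidef]
    simp only [mul_apply (M := (D * E.C) * E.V), mul_apply (M := D * E.C) (N := E.V),
      conjTranspose_apply, star_trivial, Finset.sum_mul]
    rw [Finset.sum_comm]
    exact Finset.sum_congr rfl fun _ _ => Finset.sum_congr rfl fun _ _ => by ring
  rw [h]
  refine E.V_posDef.mul_mul_conjTranspose_same ?_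
  have hu : IsUnit (D * E.C) := by
    rw [isUnit_iff_isUnit_det, det_mul]
    refine IsUnit.mul ?_ E.C_invertible
    rw [hD, det_diagonal, isUnit_iff_ne_zero, Finset.prod_ne_zero_iff]
    exact fun k _ => one_div_ne_zero (hσ k)
  exact vecMul_injective_of_isUnit hu

section Linear

variable {ι : Type*} (s : ι → ℕ × Fin K)

/-- The centered transformed states, together with the noise terms indexed by `s`. -/
def base (j : Fin K ⊕ ι) (ω : Sample K) : ℝ :=
  Sum.elim (fun k => E.transformedState k (ω.1 - E.mean)) (fun i => ω.2 (s i)) j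

variable {s}

lemma covariance_base (hs : Function.Injective s) (j j' : Fin K ⊕ ι) [DecidableEq ι] :
    cov[E.base s j, E.base s j'; E.P] = fromBlocks E.transformedCov 0 0 1 j j' := by
  have hnoise : ∀ i, MemLp (fun x : ℕ × Fin K → ℝ => x (s i)) 2
      (Measure.infinitePi fun _ : ℕ × Fin K => gaussianReal 0 1) := fun i =>
    (memLp_id_gaussianReal' 2 (by simp)).comp_measurePreserving
      (measurePreserving_eval_infinitePi (fun _ : ℕ × Fin K => gaussianReal 0 1) (s i))
  have hstate : ∀ k, MemLp (fun θ => E.transformedState k (θ - E.mean)) 2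
      (multivariateGaussian E.mean E.V) := fun k => by
    have h : (fun θ => E.transformedState k (θ - E.mean)) =
        fun θ => E.stateCLM k θ - E.stateCLM k E.mean := by
      ext θ
      rw [← stateCLM_apply, map_sub]
    rw [h]
    exact (IsGaussian.memLp_dual _ (E.stateCLM k) 2 (by simp)).sub (memLp_const _)
  have hcross : ∀ k i, cov[E.base s (.inl k), E.base s (.inr i); E.P] = 0 := fun k i =>
    covariance_fst_snd_prod (hstate k) (hnoise i)
  rcases j with k | i <;> rcases j' with k' | i'
  · have h : ∀ k, (fun θ => E.transformedState k (θ - E.mean)) =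
        fun θ => E.transformedState k θ - E.transformedState k E.mean := fun k => by
      ext θ
      simp only [← stateCLM_apply, map_sub]
    have hint : ∀ k, Integrable (E.transformedState k) (multivariateGaussian E.mean E.V) :=
      fun k => by
        have : E.transformedState k = E.stateCLM k := by ext; rw [stateCLM_apply]
        rw [this]
        exact IsGaussian.integrable_dual _ _
    have e : cov[E.base s (.inl k), E.base s (.inl k'); E.P] =
        cov[fun θ => E.transformedState k (θ - E.mean),
          fun θ => E.transformedState k' (θ - E.mean); multivariateGaussian E.mean E.V] := by
      have hfst : E.P.map Prod.fst = multivariateGaussian E.mean E.V := by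
        rw [P, Measure.map_fst_prod]; simp
      have hm : ∀ k, Measurable fun θ => E.transformedState k (θ - E.mean) := fun k => by fun_prop
      rw [← hfst, covariance_map (hm k).aestronglyMeasurable (hm k').aestronglyMeasurable
        (by fun_prop)]
      rfl
    rw [e, h, h, covariance_sub_const_left (hint k), covariance_sub_const_right (hint k')]
    simp [transformedCov]
  · simpa using hcross k i'
  · rw [covariance_comm]
    simpa using hcross k' i
  · have e : cov[E.base s (.inr i), E.base s (.inr i'); E.P] =
        cov[fun x : ℕ × Fin K → ℝ => x (s i), fun x => x (s i');
          Measure.infinitePi fun _ : ℕ × Fin K => gaussianReal 0 1] := by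
      have hsnd : E.P.map Prod.snd = Measure.infinitePi fun _ : ℕ × Fin K => gaussianReal 0 1 := by
        rw [P, Measure.map_snd_prod]; simp
      rw [← hsnd, covariance_map (measurable_pi_apply _).aestronglyMeasurable
        (measurable_pi_apply _).aestronglyMeasurable (by fun_prop)]
      rfl
    rw [e]
    by_cases hii : i = i'
    · subst hii
      rw [covariance_self (measurable_pi_apply _).aemeasurable]
      have := variance_map (X := id) (μ := Measure.infinitePi fun _ : ℕ × Fin K => gaussianReal 0 1)
        (Y := fun x => x (s i)) (by fun_prop) (measurable_pi_apply _).aemeasurable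
      rw [Measure.infinitePi_map_eval, variance_id_gaussianReal] at this
      simpa [Function.comp_def] using this.symm
    · have hind := (iIndepFun_infinitePi (P := fun _ : ℕ × Fin K => gaussianReal 0 1)
        (X := fun _ x => x) (fun _ => measurable_id)).indepFun (hs.ne hii)
      rw [hind.covariance_eq_zero (hnoise i) (hnoise i')]
      simp [one_apply_ne hii]

lemma integral_base (j : Fin K ⊕ ι) : ∫ ω, E.base s j ω ∂E.P = 0 := by
  rcases j with k | i
  · have e : ∀ ω, E.base s (.inl k) ω = E.stateCLM k ω.1 - E.stateCLM k E.mean := fun ω => by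
      simp [base, ← stateCLM_apply]
    have hfst : E.P.map Prod.fst = multivariateGaussian E.mean E.V := by
      rw [P, Measure.map_fst_prod]; simp
    have h1 : ∫ ω, E.stateCLM k ω.1 ∂E.P = E.stateCLM k E.mean := by
      rw [← integral_map (φ := Prod.fst) (μ := E.P) (f := fun θ => E.stateCLM k θ)
        measurable_fst.aemeasurable (by fun_prop), hfst,
        ContinuousLinearMap.integral_comp_comm _ IsGaussian.integrable_fun_id,
        integral_id_multivariateGaussian]
    have hi : Integrable (fun ω : Sample K => E.stateCLM k ω.1) E.P :=
      (IsGaussian.integrable_dual (multivariateGaussian E.mean E.V) (E.stateCLM k)).comp_fst _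
    simp_rw [e]
    rw [integral_sub hi (integrable_const _), h1]
    simp
  · have hsnd : E.P.map (fun ω => ω.2 (s i)) = gaussianReal 0 1 := by
      rw [← Function.comp_def (fun x : ℕ × Fin K → ℝ => x (s i)) Prod.snd,
        ← Measure.map_map (by fun_prop) measurable_snd, P, Measure.map_snd_prod]
      simp [Measure.infinitePi_map_eval]
    have := integral_map (μ := E.P) (φ := fun ω => ω.2 (s i)) (f := fun x : ℝ => x)
      (by fun_prop) (by fun_prop)
    rw [hsnd, integral_id_gaussianReal] at this
    exact this.symm

variable [Fintype ι]

variable (s) in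
/-- A linear combination of the centered transformed states and the noise terms indexed by `s`. -/
def lin (α : Fin K → ℝ) (β : ι → ℝ) (ω : Sample K) : ℝ :=
  ∑ j, Sum.elim α β j * E.base s j ω

lemma hasGaussianLaw_base (hs : Function.Injective s) :
    HasGaussianLaw (fun ω j => E.base s j ω) E.P := by
  have h1 : HasGaussianLaw (fun ω : Sample K => ω.1 - E.mean) E.P := by
    constructor
    have : E.P.map (fun ω : Sample K => ω.1 - E.mean) =
        (multivariateGaussian E.mean E.V).map (fun θ => θ - E.mean) := by
      rw [P, ← Function.comp_def (fun θ : EuclideanSpace ℝ (Fin K) => θ - E.mean) Prod.fst,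
        ← Measure.map_map (by fun_prop) measurable_fst, Measure.map_fst_prod]
      simp
    rw [this]
    infer_instance
  have h2 : HasGaussianLaw (fun (ω : Sample K) (i : ι) => ω.2 (s i)) E.P := by
    constructor
    have : E.P.map (fun (ω : Sample K) (i : ι) => ω.2 (s i)) =
        (Measure.infinitePi fun _ : ℕ × Fin K => gaussianReal 0 1).map
          (fun x (i : ι) => x (s i)) := by
      rw [P, ← Function.comp_def (fun (x : ℕ × Fin K → ℝ) (i : ι) => x (s i)) Prod.snd,
        ← Measure.map_map (by fun_prop) measurable_snd, Measure.map_snd_prod]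
      simp
    rw [this]
    refine (iIndepFun.hasGaussianLaw (fun i => ⟨?_⟩)
      ((iIndepFun_infinitePi (X := fun _ x => x) (fun _ => measurable_id)).precomp
        hs)).isGaussian_map
    rw [(measurePreserving_eval_infinitePi _ (s i)).map_eq]
    infer_instance
  have h12 : IndepFun (fun ω : Sample K => ω.1 - E.mean)
      (fun (ω : Sample K) (i : ι) => ω.2 (s i)) E.P :=
    indepFun_prod (X := fun θ : EuclideanSpace ℝ (Fin K) => θ - E.mean)
      (Y := fun (x : ℕ × Fin K → ℝ) (i : ι) => x (s i)) (by fun_prop) (by fun_prop)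
  have h := (h12.hasGaussianLaw h1 h2).map_fun (ContinuousLinearMap.pi
    (Sum.elim (fun k => (E.stateCLM k).comp (ContinuousLinearMap.fst ℝ _ _))
      (fun i => (ContinuousLinearMap.proj (R := ℝ) (φ := fun _ : ι => ℝ) i).comp
        (ContinuousLinearMap.snd ℝ (EuclideanSpace ℝ (Fin K)) _))))
  refine h.congr (.of_forall fun ω => ?_)
  ext j
  rcases j with k | i
  · simp [base, stateCLM_apply]
  · simp [base]

lemma memLp_base (hs : Function.Injective s) (j : Fin K ⊕ ι) : MemLp (E.base s j) 2 E.P :=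
  ((E.hasGaussianLaw_base hs).eval j).memLp_two

lemma memLp_lin (hs : Function.Injective s) (α : Fin K → ℝ) (β : ι → ℝ) :
    MemLp (E.lin s α β) 2 E.P :=
  memLp_finsetSum _ fun j _ => (E.memLp_base hs j).const_mul _

lemma covariance_lin (hs : Function.Injective s) (α α' : Fin K → ℝ) (β β' : ι → ℝ) :
    cov[E.lin s α β, E.lin s α' β'; E.P] = α ⬝ᵥ E.transformedCov *ᵥ α' + β ⬝ᵥ β' := by
  classical
  unfold lin
  rw [covariance_fun_sum_fun_sum (fun j => (E.memLp_base hs j).const_mul _)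
    (fun j => (E.memLp_base hs j).const_mul _)]
  simp_rw [covariance_const_mul_left, covariance_const_mul_right, E.covariance_base hs]
  simp only [Fintype.sum_sum_type, Sum.elim_inl, Sum.elim_inr, fromBlocks_apply₁₁,
    fromBlocks_apply₁₂, fromBlocks_apply₂₁, fromBlocks_apply₂₂, Matrix.zero_apply, one_apply]
  simp [dotProduct, mulVec, Finset.mul_sum, mul_comm]

lemma integral_lin (hs : Function.Injective s) (α : Fin K → ℝ) (β : ι → ℝ) :
    ∫ ω, E.lin s α β ω ∂E.P = 0 := by
  unfold lin
  rw [integral_finsetSum _ fun j _ =>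
    ((E.memLp_base hs j).integrable (by norm_num)).const_mul _]
  simp [integral_const_mul, E.integral_base]

lemma hasGaussianLaw_lin {κ : Type*} [Fintype κ] (hs : Function.Injective s)
    (α : κ → Fin K → ℝ) (β : κ → ι → ℝ) :
    HasGaussianLaw (fun ω i => E.lin s (α i) (β i) ω) E.P := by
  have h := (E.hasGaussianLaw_base hs).map_fun (ContinuousLinearMap.pi fun i : κ =>
    ∑ j, Sum.elim (α i) (β i) j • ContinuousLinearMap.proj (R := ℝ)
      (φ := fun _ : Fin K ⊕ ι => ℝ) j)
  refine h.congr (.of_forall fun ω => ?_)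
  ext i
  simp [lin]

/-- For jointly Gaussian variables, being uncorrelated amounts to independence; all independence
claims about posterior means rest on this. -/
lemma indepFun_lin {κ : Type*} [Fintype κ] (hs : Function.Injective s)
    (α₀ : Fin K → ℝ) (β₀ : ι → ℝ) (α : κ → Fin K → ℝ) (β : κ → ι → ℝ)
    (h : ∀ i, cov[E.lin s α₀ β₀, E.lin s (α i) (β i); E.P] = 0) :
    IndepFun (E.lin s α₀ β₀) (fun ω i => E.lin s (α i) (β i) ω) E.P := by
  have hg := E.hasGaussianLaw_lin hs (Option.elim · α₀ α) (Option.elim · β₀ β)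
  have hg2 := hg.map_fun ((ContinuousLinearMap.pi fun _ : Unit => ContinuousLinearMap.proj (R := ℝ)
    (φ := fun _ : Option κ => ℝ) none).prod (ContinuousLinearMap.pi fun i : κ =>
      ContinuousLinearMap.proj (R := ℝ) (φ := fun _ : Option κ => ℝ) (some i)))
  have hi := HasGaussianLaw.indepFun_of_covariance_eval
    (X := fun (_ : Unit) => E.lin s α₀ β₀) (Y := fun i => E.lin s (α i) (β i))
    (P := E.P) (hg2.congr (.of_forall fun ω => rfl)) (fun _ i => h i)
  exact hi.comp (φ := fun x : Unit → ℝ => x ()) (ψ := id) (by fun_prop) measurable_id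

end Linear

end Environment

/-! ### Posterior mean and residual for a fixed family of observations -/

namespace Environment

variable {K : ℕ} (E : Environment K)

/-- How often each source occurs in a finite family of sources. -/
def count {ι : Type*} [Fintype ι] (κ : ι → Fin K) (k : Fin K) : ℕ :=
  (Finset.univ.filter fun i => κ i = k).card

lemma sum_comp_eq_sum_count {ι : Type*} [Fintype ι] (κ : ι → Fin K) (f : Fin K → ℝ) :
    ∑ i, f (κ i) = ∑ k, count κ k * f k := by
  rw [← Finset.sum_fiberwise' Finset.univ κ f]
  simp [count]

/-- The posterior mean of the sum of the transformed states, given the realizations `x` of the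
sources `κ`. -/
def postMean {ι : Type*} [Fintype ι] (κ : ι → Fin K) (x : ι → ℝ) : ℝ :=
  ∑ k, E.transformedState k E.mean + ∑ i, precWeight E.transformedCov⁻¹ (count κ) (κ i) *
    (x i / E.σ (κ i) - E.transformedState (κ i) E.mean)

@[fun_prop]
lemma measurable_postMean {ι : Type*} [Fintype ι] (κ : ι → Fin K) : Measurable (E.postMean κ) := by
  unfold postMean
  fun_prop

/-- The posterior variance of the sum of the transformed states. -/
def stateVar (q : Fin K → ℕ) : ℝ := precVar E.transformedCov⁻¹ q

section Residual

variable {ι : Type*} (s : ι → ℕ × Fin K)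

/-- The realizations indexed by `s`. -/
def obs (ω : Sample K) (i : ι) : ℝ := E.signal (s i).1 (s i).2 ω

@[fun_prop]
lemma measurable_obs : Measurable (E.obs s) := by
  unfold obs
  fun_prop

variable [Fintype ι]

lemma obs_eq [DecidableEq ι] (ω : Sample K) (i : ι) : E.obs s ω i =
    E.σ (s i).2 * (E.transformedState (s i).2 E.mean +
      E.lin s (Pi.single (s i).2 1) (Pi.single i 1) ω) := by
  have hσ : E.σ (s i).2 ≠ 0 := (E.σ_pos _).ne'
  have h1 : E.transformedState (s i).2 (ω.1 - E.mean) =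
      E.transformedState (s i).2 ω.1 - E.transformedState (s i).2 E.mean := by
    simp only [← stateCLM_apply, map_sub]
  have h2 : E.lin s (Pi.single (s i).2 1) (Pi.single i 1) ω =
      E.transformedState (s i).2 (ω.1 - E.mean) + ω.2 (s i) := by
    simp [lin, base, Fintype.sum_sum_type, Pi.single_apply]
  have h3 : E.σ (s i).2 * E.transformedState (s i).2 ω.1 = ∑ j, E.C (s i).2 j * ω.1 j := by
    rw [transformedState]
    field_simp
  rw [h2, h1, obs, signal, ← h3]
  ring

variable [NeZero K]

/-- The difference between the payoff-relevant state and its posterior mean. -/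
def resid (ω : Sample K) : ℝ := ω.1 0 - E.postMean (fun i => (s i).2) (E.obs s ω)

@[fun_prop]
lemma measurable_resid : Measurable (E.resid s) := by
  unfold resid
  fun_prop

variable {s}
variable (hw : ∀ θ : EuclideanSpace ℝ (Fin K), θ 0 = ∑ k, E.transformedState k θ)
include hw

/-- With `a` the weights, the equation `(A + diag q) a = 1` says that the state coefficients `1 -
q_k a_k` left after subtracting the posterior mean are those of `A a`. -/
lemma resid_eq (ω : Sample K) : E.resid s ω =
    E.lin s (E.transformedCov⁻¹ *ᵥ precWeight E.transformedCov⁻¹ (count fun i => (s i).2))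
      (fun i => -precWeight E.transformedCov⁻¹ (count fun i => (s i).2) (s i).2) ω := by
  classical
  set a := precWeight E.transformedCov⁻¹ (count fun i => (s i).2) with ha
  set x : Fin K → ℝ := fun k => E.transformedState k (ω.1 - E.mean) with hx
  have h0 : ω.1 0 = ∑ k, E.transformedState k E.mean + ∑ k, x k := by
    rw [hw, ← Finset.sum_add_distrib]
    refine Finset.sum_congr rfl fun k _ => ?_
    rw [hx]
    simp only [← stateCLM_apply, map_sub]
    ring
  have hobs : ∀ i, E.obs s ω i / E.σ (s i).2 - E.transformedState (s i).2 E.mean =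
      x (s i).2 + ω.2 (s i) := fun i => by
    have hσ : E.σ (s i).2 ≠ 0 := (E.σ_pos _).ne'
    rw [obs_eq, mul_div_cancel_left₀ _ hσ, add_sub_cancel_left]
    simp [lin, base, Fintype.sum_sum_type, Pi.single_apply, hx]
  have hA : ∀ k, (E.transformedCov⁻¹ *ᵥ a) k = 1 - count (fun i => (s i).2) k * a k := fun k => by
    have := congrFun (precision_mulVec_precWeight E.transformedCov_posDef.inv
      (count fun i => (s i).2)) k
    rw [precision_mulVec_apply, ← ha, Pi.one_apply] at this
    linarith
  rw [resid, postMean, h0, ← ha]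
  simp_rw [hobs]
  simp only [lin, base, Fintype.sum_sum_type, Sum.elim_inl, Sum.elim_inr, mul_add, neg_mul,
    Finset.sum_add_distrib, Finset.sum_neg_distrib]
  rw [sum_comp_eq_sum_count (fun i => (s i).2) fun k => a k * x k]
  simp_rw [hA, sub_mul, one_mul, Finset.sum_sub_distrib, mul_assoc]
  ring

lemma memLp_resid (hs : Function.Injective s) : MemLp (E.resid s) 2 E.P := by
  rw [show E.resid s = _ from funext (E.resid_eq hw)]
  exact E.memLp_lin hs _ _

lemma integral_resid (hs : Function.Injective s) : ∫ ω, E.resid s ω ∂E.P = 0 := by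
  simp_rw [E.resid_eq hw]
  exact E.integral_lin hs _ _

omit [Fintype ι] [NeZero K] hw in
lemma cov_mulVec_inv (x : Fin K → ℝ) : E.transformedCov *ᵥ (E.transformedCov⁻¹ *ᵥ x) = x := by
  have h := E.transformedCov_posDef.isUnit
  rw [isUnit_iff_isUnit_det] at h
  rw [mulVec_mulVec, mul_nonsing_inv _ h, one_mulVec]

/-- The orthogonality that makes `postMean` a conditional expectation: the states contribute the
weight of the observed source, and the noise contributes its negative. -/
lemma covariance_resid_lin [DecidableEq ι] (hs : Function.Injective s) (i : ι) :
    cov[E.resid s, E.lin s (Pi.single (s i).2 1) (Pi.single i 1); E.P] = 0 := by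
  rw [show E.resid s = _ from funext (E.resid_eq hw), E.covariance_lin hs,
    dotProduct_mulVec_symm E.transformedCov_posDef.isHermitian, cov_mulVec_inv]
  simp

lemma variance_resid (hs : Function.Injective s) :
    Var[E.resid s; E.P] = E.stateVar (count fun i => (s i).2) := by
  rw [← covariance_self (by fun_prop), show E.resid s = _ from funext (E.resid_eq hw),
    E.covariance_lin hs, cov_mulVec_inv]
  set a := precWeight E.transformedCov⁻¹ (count fun i => (s i).2) with ha
  have h : (fun i => -a (s i).2) ⬝ᵥ (fun i => -a (s i).2) =
      ∑ k, count (fun i => (s i).2) k * (a k * a k) := by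
    rw [← sum_comp_eq_sum_count (fun i => (s i).2) fun k => a k * a k]
    simp [dotProduct]
  rw [h, stateVar, precVar, ← ha, dotProduct, ← Finset.sum_add_distrib]
  refine Finset.sum_congr rfl fun k _ => ?_
  have := congrFun (precision_mulVec_precWeight E.transformedCov_posDef.inv
    (count fun i => (s i).2)) k
  rw [precision_mulVec_apply, ← ha, Pi.one_apply] at this
  linear_combination a k * this

omit [NeZero K] hw in
/-- A linear combination uncorrelated with all realizations is independent of them. -/
lemma indepFun_lin_obs {κ : Type*} [Fintype κ] [DecidableEq ι] (hs : Function.Injective s)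
    (e : κ → ι) (α : Fin K → ℝ) (β : ι → ℝ)
    (h : ∀ i, cov[E.lin s α β, E.lin s (Pi.single (s (e i)).2 1) (Pi.single (e i) 1); E.P] = 0) :
    IndepFun (E.lin s α β) (E.obs (s ∘ e)) E.P := by
  have hi := E.indepFun_lin hs α β (fun i : κ => Pi.single (s (e i)).2 1)
    (fun i => Pi.single (e i) 1) h
  have := hi.comp (φ := id) (ψ := fun (x : κ → ℝ) i => E.σ (s (e i)).2 *
    (E.transformedState (s (e i)).2 E.mean + x i)) measurable_id (by fun_prop)
  rwa [show E.obs (s ∘ e) = _ from funext fun ω => funext fun i => E.obs_eq s ω (e i)]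

lemma indepFun_resid_obs (hs : Function.Injective s) : IndepFun (E.resid s) (E.obs s) E.P := by
  classical
  have h := E.covariance_resid_lin hw hs
  rw [show E.resid s = _ from funext (E.resid_eq hw)] at h ⊢
  exact E.indepFun_lin_obs hs id _ _ h

omit [NeZero K] hw in
lemma map_lin (hs : Function.Injective s) (α : Fin K → ℝ) (β : ι → ℝ) :
    E.P.map (E.lin s α β) = gaussianReal 0 (Var[E.lin s α β; E.P]).toNNReal := by
  have h := ((E.hasGaussianLaw_lin hs (fun _ : Unit => α) fun _ => β).eval ()).map_eq_gaussianReal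
  rwa [E.integral_lin hs] at h

lemma map_resid (hs : Function.Injective s) :
    E.P.map (E.resid s) = gaussianReal 0 (E.stateVar (count fun i => (s i).2)).toNNReal := by
  rw [← E.variance_resid hw hs, show E.resid s = _ from funext (E.resid_eq hw)]
  exact E.map_lin hs _ _

lemma stateVar_count_nonneg (hs : Function.Injective s) :
    0 ≤ E.stateVar (count fun i => (s i).2) := by
  rw [← E.variance_resid hw hs]
  exact variance_nonneg _ _

end Residual

/-! ### Revisions of the posterior mean -/

section Increment

variable [NeZero K]
variable (hw : ∀ θ : EuclideanSpace ℝ (Fin K), θ 0 = ∑ k, E.transformedState k θ)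

variable {ι ι' : Type*} [Fintype ι] [Fintype ι'] {s : ι → ℕ × Fin K} {s' : ι' → ℕ × Fin K}
  (hs' : Function.Injective s') {e : ι → ι'} (he : Function.Injective e)

omit [NeZero K] in
lemma lin_eq_lin_extend (he : Function.Injective e) (α : Fin K → ℝ) (β : ι → ℝ) :
    E.lin (s' ∘ e) α β = E.lin s' α (Function.extend e β 0) := by
  ext ω
  simp only [lin, Fintype.sum_sum_type, Sum.elim_inl, Sum.elim_inr]
  congr 1
  refine Fintype.sum_of_injective e he _ _ (fun i hi => ?_) (fun i => ?_)
  · rw [Function.extend_apply' _ _ _ fun ⟨a, ha⟩ => hi ⟨a, ha⟩]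
    simp
  · rw [he.extend_apply]
    simp [base]

omit [NeZero K] in
lemma lin_sub (α α' : Fin K → ℝ) (β β' : ι → ℝ) (ω : Sample K) :
    E.lin s α β ω - E.lin s α' β' ω = E.lin s (α - α') (β - β') ω := by
  simp only [lin, ← Finset.sum_sub_distrib]
  refine Finset.sum_congr rfl fun j _ => ?_
  rcases j with j | j <;> simp [sub_mul]

/-- The revision of the posterior mean when the family of observations grows. -/
def revision (s : ι → ℕ × Fin K) (s' : ι' → ℕ × Fin K) (ω : Sample K) : ℝ :=
  E.postMean (fun i => (s' i).2) (E.obs s' ω) - E.postMean (fun i => (s i).2) (E.obs s ω)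

lemma revision_eq (ω : Sample K) : E.revision s s' ω = E.resid s ω - E.resid s' ω := by
  simp [revision, resid]

include hw he

lemma exists_revision_eq_lin :
    ∃ α β, ∀ ω, E.revision (s' ∘ e) s' ω = E.lin s' α β ω := by
  exact ⟨_, _, fun ω => (E.revision_eq ω).trans ((congrArg₂ (· - ·) ((E.resid_eq hw ω).trans
    (congrFun (E.lin_eq_lin_extend he _ _) ω)) (E.resid_eq hw ω)).trans (E.lin_sub _ _ _ _ ω))⟩

include hs'

/-- A revision is the difference of the old and the new residual, and both are uncorrelated with the
old observations. -/
lemma indepFun_revision_obs : IndepFun (E.revision (s' ∘ e) s') (E.obs (s' ∘ e)) E.P := by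
  classical
  obtain ⟨α, β, h⟩ := E.exists_revision_eq_lin (s' := s') hw he
  have h1 : E.revision (s' ∘ e) s' = E.resid (s' ∘ e) - E.resid s' :=
    funext fun ω => E.revision_eq ω
  rw [show E.revision (s' ∘ e) s' = _ from funext h] at h1 ⊢
  refine E.indepFun_lin_obs hs' e α β fun i => ?_
  rw [h1, covariance_sub_left (E.memLp_resid hw (hs'.comp he)) (E.memLp_resid hw hs')
    (E.memLp_lin hs' _ _), E.covariance_resid_lin hw hs', sub_zero]
  have h2 := E.covariance_resid_lin hw (hs'.comp he) i
  have hext : Function.extend e (Pi.single i (1 : ℝ)) 0 = Pi.single (e i) 1 := by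
    ext j
    by_cases hj : ∃ k, e k = j
    · obtain ⟨k, rfl⟩ := hj
      rw [he.extend_apply]
      simp [Pi.single_apply, he.eq_iff]
    · rw [Function.extend_apply' _ _ _ hj, Pi.single_apply, if_neg fun h => hj ⟨i, h.symm⟩]
      rfl
  rwa [E.lin_eq_lin_extend he, hext] at h2

/-- The old residual is the sum of the revision and the new residual. The revision is a function of
all observations, hence independent of the new residual, and variances add. -/
lemma variance_revision : Var[E.revision (s' ∘ e) s'; E.P] =
    E.stateVar (count fun i => (s' (e i)).2) - E.stateVar (count fun i => (s' i).2) := by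
  obtain ⟨α, β, h⟩ := E.exists_revision_eq_lin (s' := s') hw he
  have hm : MemLp (E.revision (s' ∘ e) s') 2 E.P := by
    rw [show E.revision (s' ∘ e) s' = _ from funext h]
    exact E.memLp_lin hs' _ _
  have hi : IndepFun (E.revision (s' ∘ e) s') (E.resid s') E.P :=
    ((E.indepFun_resid_obs hw hs').symm.comp (φ := fun x =>
      E.postMean (fun i => (s' i).2) x - E.postMean (fun i => (s' (e i)).2) fun i => x (e i))
      (ψ := id) (by fun_prop) measurable_id)
  have hsum : E.resid (s' ∘ e) = E.revision (s' ∘ e) s' + E.resid s' := by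
    ext ω
    simp [revision_eq]
  have h1 := hi.variance_add hm (E.memLp_resid hw hs')
  rw [← hsum, E.variance_resid hw (hs'.comp he), E.variance_resid hw hs'] at h1
  have h2 : E.stateVar (count fun i => ((s' ∘ e) i).2) =
    E.stateVar (count fun i => (s' (e i)).2) := rfl
  linarith

lemma map_revision : E.P.map (E.revision (s' ∘ e) s') = gaussianReal 0
    (E.stateVar (count fun i => (s' (e i)).2) - E.stateVar (count fun i => (s' i).2)).toNNReal := by
  obtain ⟨α, β, h⟩ := E.exists_revision_eq_lin (s' := s') hw he
  rw [← E.variance_revision hw hs' he, show E.revision (s' ∘ e) s' = _ from funext h]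
  exact E.map_lin hs' _ _

end Increment

/-- The residual is centered and independent of the observations, so `postMean` is the conditional
expectation and the mean conditional variance is the variance of the residual. -/
lemma postVar_eq_stateVar [NeZero K]
    (hw : ∀ θ : EuclideanSpace ℝ (Fin K), θ 0 = ∑ k, E.transformedState k θ) (q : Fin K → ℕ) :
    E.postVar q = E.stateVar q := by
  set s : (k : Fin K) × Fin (q k) → ℕ × Fin K := fun p => (p.2, p.1) with hs
  have hinj : Function.Injective s := by
    rintro ⟨k, i⟩ ⟨k', i'⟩ h
    simp only [hs, Prod.mk.injEq] at h
    obtain ⟨h1, rfl⟩ := h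
    rw [Fin.val_inj.1 h1]
  have hcount : (count fun p => (s p).2) = q := by
    ext k
    have : (Finset.univ.filter fun p : (k : Fin K) × Fin (q k) => p.1 = k) =
        Finset.univ.map ⟨fun i : Fin (q k) => ⟨k, i⟩, fun i j h => by simpa using h⟩ := by
      ext ⟨k', i⟩
      constructor
      · intro h
        simp only [Finset.mem_filter, Finset.mem_univ, true_and] at h
        subst h
        exact Finset.mem_map.2 ⟨i, Finset.mem_univ i, rfl⟩
      · intro h
        simp only [Finset.mem_map, Finset.mem_univ, true_and] at h
        obtain ⟨j, hj⟩ := h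
        simp [(Sigma.mk.inj hj).1.symm]
    simp only [count, hs]
    rw [this, Finset.card_map]
    simp
  have hobs : E.observed q = MeasurableSpace.comap (E.obs s) inferInstance := rfl
  have hm : E.observed q ≤ Prod.instMeasurableSpace := by
    rw [hobs]
    exact (E.measurable_obs s).comap_le
  have hpm : StronglyMeasurable[E.observed q]
      fun ω => E.postMean (fun i => (s i).2) (E.obs s ω) := by
    refine Measurable.stronglyMeasurable ?_
    exact (E.measurable_postMean _).comp (comap_measurable (E.obs s))
  have hri : Integrable (E.resid s) E.P := (E.memLp_resid hw hinj).integrable (by norm_num)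
  have h0i : Integrable (fun ω : Sample K => ω.1 0) E.P :=
    (IsGaussian.integrable_dual (multivariateGaussian E.mean E.V)
      (EuclideanSpace.proj (𝕜 := ℝ) (0 : Fin K))).comp_fst _
  have hpi : Integrable (fun ω => E.postMean (fun i => (s i).2) (E.obs s ω)) E.P := by
    refine (h0i.sub hri).congr (.of_forall fun ω => ?_)
    simp [resid]
  have hce : E.P[fun ω : Sample K => ω.1 0 | E.observed q] =ᵐ[E.P]
      fun ω => E.postMean (fun i => (s i).2) (E.obs s ω) := by
    have h1 : (fun ω : Sample K => ω.1 0) =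
        (fun ω => E.postMean (fun i => (s i).2) (E.obs s ω)) + E.resid s := by
      ext ω
      simp [resid]
    have h2 := condExp_add hpi hri (E.observed q)
    have h3 : E.P[E.resid s | E.observed q] =ᵐ[E.P] fun _ => ∫ ω, E.resid s ω ∂E.P :=
      condExp_indep_eq (E.measurable_resid s).comap_le hm
        (comap_measurable (E.resid s)).stronglyMeasurable (E.indepFun_resid_obs hw hinj)
    rw [condExp_of_stronglyMeasurable hm hpm hpi] at h2
    rw [h1]
    filter_upwards [h2, h3] with ω h2 h3
    rw [h2, Pi.add_apply, h3, E.integral_resid hw hinj, add_zero]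
  rw [postVar, condVar, integral_condExp hm, ← congrArg E.stateVar hcount, ← E.variance_resid hw hinj,
    variance_eq_integral (by fun_prop), E.integral_resid hw hinj]
  refine integral_congr_ae ?_
  filter_upwards [hce] with ω h
  simp [h, resid]

end Environment

/-! ### Conditionally normal laws -/

section CondNormal

open scoped ENNReal

variable {Ω H : Type*} [MeasurableSpace Ω] [MeasurableSpace H]

/-- The joint law of a variable with law `ν` and one that is conditionally normal given it, with
conditional mean `m` and conditional variance `w`. -/
def condNormal (ν : Measure H) (m w : H → ℝ) : Measure (H × ℝ) :=
  (ν.prod (gaussianReal 0 1)).map fun p => (p.1, m p.1 + √(w p.1) * p.2)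

/-- No sign condition is needed: for negative `v` both `√v` and `v.toNNReal` are 0. -/
lemma gaussianReal_map_sqrt_mul (v : ℝ) :
    (gaussianReal 0 1).map (fun z => √v * z) = gaussianReal 0 v.toNNReal := by
  rw [gaussianReal_map_const_mul]
  congr 1
  · simp
  · ext
    simp [Real.sq_sqrt', Real.coe_toNNReal']

lemma lintegral_gaussianReal_toNNReal (v : ℝ) {g : ℝ → ℝ≥0∞} (hg : Measurable g) :
    ∫⁻ z, g z ∂(gaussianReal 0 v.toNNReal) = ∫⁻ z, g (√v * z) ∂(gaussianReal 0 1) := by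
  rw [← gaussianReal_map_sqrt_mul, lintegral_map hg (by fun_prop)]

lemma lintegral_condNormal {ν : Measure H} {m w : H → ℝ} (hm : Measurable m) (hw : Measurable w)
    {g : H × ℝ → ℝ≥0∞} (hg : Measurable g) :
    ∫⁻ p, g p ∂(condNormal ν m w) =
      ∫⁻ h, ∫⁻ z, g (h, m h + √(w h) * z) ∂(gaussianReal 0 1) ∂ν := by
  rw [condNormal, lintegral_map hg (by fun_prop), lintegral_prod _ (by fun_prop)]

lemma lintegral_gaussianReal_add {a b : ℝ} (ha : 0 ≤ a) (hb : 0 ≤ b) {g : ℝ → ℝ≥0∞}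
    (hg : Measurable g) :
    ∫⁻ x, ∫⁻ y, g (√a * x + √b * y) ∂(gaussianReal 0 1) ∂(gaussianReal 0 1) =
      ∫⁻ z, g (√(a + b) * z) ∂(gaussianReal 0 1) := by
  have h := gaussianReal_conv_gaussianReal (m₁ := 0) (m₂ := 0) (v₁ := a.toNNReal)
    (v₂ := b.toNNReal)
  rw [← Real.toNNReal_add ha hb, add_zero] at h
  rw [← lintegral_gaussianReal_toNNReal _ hg, ← h, Measure.lintegral_conv hg,
    lintegral_gaussianReal_toNNReal a (g := fun x => ∫⁻ y, g (x + y) ∂_)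
      (Measurable.lintegral_prod_right' (f := fun p : ℝ × ℝ => g (p.1 + p.2)) (by fun_prop))]
  refine lintegral_congr fun x => ?_
  rw [lintegral_gaussianReal_toNNReal b (g := fun y => g (√a * x + y)) (by fun_prop)]

/-- Adding independent normal noise to a conditionally normal variable. -/
lemma map_add_noise_eq_condNormal {P : Measure Ω} [IsProbabilityMeasure P] {X : Ω → H} {T : Ω → ℝ}
    (hX : Measurable X) (hT : Measurable T) {m w w' : H → ℝ} (hm : Measurable m)
    (hw : Measurable w) (hw' : Measurable w') (hw0 : ∀ᵐ h ∂(P.map X), 0 ≤ w h)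
    (hw0' : ∀ᵐ h ∂(P.map X), 0 ≤ w' h)
    (h : P.map (fun ω => (X ω, T ω)) = condNormal (P.map X) m w) :
    (P.prod (gaussianReal 0 1)).map (fun p => (X p.1, T p.1 + √(w' (X p.1)) * p.2)) =
      condNormal (P.map X) m (w + w') := by
  refine Measure.ext_of_lintegral _ fun g hg => ?_
  have hG : Measurable fun q : (H × ℝ) × ℝ => g (q.1.1, q.1.2 + √(w' q.1.1) * q.2) := by fun_prop
  rw [lintegral_map hg (by fun_prop), lintegral_prod _ (by fun_prop),
    lintegral_condNormal hm (hw.add hw') hg]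
  calc ∫⁻ ω, ∫⁻ z, g (X ω, T ω + √(w' (X ω)) * z) ∂(gaussianReal 0 1) ∂P
      = ∫⁻ q : H × ℝ, ∫⁻ z, g (q.1, q.2 + √(w' q.1) * z) ∂(gaussianReal 0 1)
          ∂(P.map fun ω => (X ω, T ω)) := by
        rw [lintegral_map hG.lintegral_prod_right' (by fun_prop)]
    _ = ∫⁻ x, ∫⁻ y, ∫⁻ z, g (x, m x + √(w x) * y + √(w' x) * z) ∂(gaussianReal 0 1)
          ∂(gaussianReal 0 1) ∂(P.map X) := by
        rw [h, lintegral_condNormal hm hw hG.lintegral_prod_right']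
    _ = _ := by
        refine lintegral_congr_ae ?_
        filter_upwards [hw0, hw0'] with x h0 h0'
        rw [Pi.add_apply, ← lintegral_gaussianReal_add h0 h0'
          (g := fun y => g (x, m x + y)) (by fun_prop)]
        simp_rw [add_assoc]

/-- If a variable is normal around `m`, given an observation, in each of countably many cases that
the observation itself distinguishes, then it is conditionally normal. -/
lemma map_eq_condNormal_of_cases {I : Type*} [Countable I] [MeasurableSpace I]
    [MeasurableSingletonClass I] {P : Measure Ω} [IsProbabilityMeasure P] {X : Ω → H} {T : Ω → ℝ}
    (hX : Measurable X) (hT : Measurable T) {C : H → I} (hC : Measurable C) {m : H → ℝ}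
    {v : I → ℝ} (hm : Measurable m) {Y : I → Ω → H} {Z : I → Ω → ℝ} (hY : ∀ i, Measurable (Y i))
    (hZ : ∀ i, Measurable (Z i)) (hiff : ∀ i ω, C (X ω) = i ↔ C (Y i ω) = i)
    (hXY : ∀ i ω, C (X ω) = i → X ω = Y i ω)
    (hTZ : ∀ i ω, C (X ω) = i → T ω = m (Y i ω) + Z i ω)
    (hind : ∀ i, IndepFun (Z i) (Y i) P)
    (hlaw : ∀ i, P.map (Z i) = gaussianReal 0 (v i).toNNReal) :
    P.map (fun ω => (X ω, T ω)) = condNormal (P.map X) m (fun h => v (C h)) := by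
  have hv : Measurable v := measurable_of_countable v
  refine Measure.ext_of_lintegral _ fun g hg => ?_
  have hin : Measurable fun h => ∫⁻ z, g (h, m h + √(v (C h)) * z) ∂(gaussianReal 0 1) :=
    Measurable.lintegral_prod_right' (f := fun q : H × ℝ => g (q.1, m q.1 + √(v (C q.1)) * q.2))
      (by fun_prop)
  rw [lintegral_condNormal hm (by fun_prop) hg, lintegral_map hg (by fun_prop),
    lintegral_map hin hX]
  have hS : ∀ i, MeasurableSet {ω | C (X ω) = i} := fun i =>
    (hC.comp hX) (measurableSet_singleton i)
  have hU : (⋃ i, {ω | C (X ω) = i}) = Set.univ := by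
    ext ω
    simp
  have hD : Pairwise (Function.onFun Disjoint fun i => {ω | C (X ω) = i}) := fun i j hij =>
    Set.disjoint_left.2 fun ω (h : C (X ω) = i) (h' : C (X ω) = j) => hij (h ▸ h')
  rw [← setLIntegral_univ, ← hU, lintegral_iUnion hS hD, ← setLIntegral_univ (μ := P) fun ω =>
    ∫⁻ z, g (X ω, m (X ω) + √(v (C (X ω))) * z) ∂(gaussianReal 0 1), ← hU,
    lintegral_iUnion hS hD]
  refine tsum_congr fun i => ?_
  set s : Set H := {h | C h = i} with hs
  have hsm : MeasurableSet s := hC (measurableSet_singleton i)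
  -- By `hiff` case `i` is an event in `Y i` alone. Its indicator can thus be absorbed into the test
  -- function without spoiling the independence of `Y i` and `Z i`.
  set G : H × ℝ → ℝ≥0∞ := (s ×ˢ Set.univ).indicator fun q => g (q.1, m q.1 + q.2) with hG
  have hGm : Measurable G := (by fun_prop : Measurable fun q : H × ℝ =>
    g (q.1, m q.1 + q.2)).indicator (hsm.prod .univ)
  have hGa : ∀ x z, G (x, z) = s.indicator (fun x => g (x, m x + z)) x := fun x z => by
    by_cases hx : x ∈ s <;> simp [hG, hx]
  have hmap : P.map (fun ω => (Y i ω, Z i ω)) =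
      (P.map (Y i)).prod (gaussianReal 0 (v i).toNNReal) := by
    rw [(indepFun_iff_map_prod_eq_prod_map_map (hY i).aemeasurable (hZ i).aemeasurable).1
      (hind i).symm, hlaw]
  calc ∫⁻ ω in {ω | C (X ω) = i}, g (X ω, T ω) ∂P = ∫⁻ ω, G (Y i ω, Z i ω) ∂P := by
        rw [← lintegral_indicator (hS i)]
        refine lintegral_congr fun ω => ?_
        rw [hGa]
        by_cases h : C (X ω) = i
        · rw [Set.indicator_of_mem (by exact h), Set.indicator_of_mem (by exact (hiff i ω).1 h),
            hTZ i ω h, hXY i ω h]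
        · rw [Set.indicator_of_notMem (by exact h),
            Set.indicator_of_notMem (by exact fun h' => h ((hiff i ω).2 h'))]
    _ = ∫⁻ x, ∫⁻ z, G (x, √(v i) * z) ∂(gaussianReal 0 1) ∂(P.map (Y i)) := by
        rw [← lintegral_map hGm ((hY i).prodMk (hZ i)), hmap, lintegral_prod _ (by fun_prop)]
        exact lintegral_congr fun x => lintegral_gaussianReal_toNNReal _ (by fun_prop)
    _ = ∫⁻ ω, ∫⁻ z, G (Y i ω, √(v i) * z) ∂(gaussianReal 0 1) ∂P := by
        rw [lintegral_map (Measurable.lintegral_prod_right'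
          (f := fun q : H × ℝ => G (q.1, √(v i) * q.2)) (by fun_prop)) (hY i)]
    _ = _ := by
        rw [← lintegral_indicator (hS i)]
        refine lintegral_congr fun ω => ?_
        simp_rw [hGa]
        by_cases h : C (X ω) = i
        · have h' : Y i ω ∈ s := (hiff i ω).1 h
          simp_rw [Set.indicator_of_mem h']
          rw [Set.indicator_of_mem (by exact h), hXY i ω h, show C (Y i ω) = i from h']
        · have h' : Y i ω ∉ s := fun h' => h ((hiff i ω).2 h')
          simp_rw [Set.indicator_of_notMem h']
          rw [Set.indicator_of_notMem (by exact h), lintegral_zero]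

end CondNormal

/-! ### Histories under adaptive strategies -/

section Histories

variable {K B : ℕ}

/-- The sources chosen along a history. -/
def InfoStrategy.chosen (S : InfoStrategy K B) {t : ℕ} (h : History B t) (p : Fin t × Fin B) :
    Fin K :=
  S.choose p.1 (fun r : Fin p.1 => h (Fin.castLE p.1.isLt.le r)) p.2

lemma InfoStrategy.measurable_chosen (S : InfoStrategy K B) (t : ℕ) :
    Measurable fun h : History B t => S.chosen h := by
  refine measurable_pi_iff.2 fun p => ?_
  exact (measurable_pi_apply p.2).comp ((S.measurable_choose p.1).comp (by fun_prop))

lemma InfoStrategy.count_chosen (S : InfoStrategy K B) {t : ℕ} (h : History B t) :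
    Environment.count (S.chosen h) = S.division h := by
  ext k
  simp only [Environment.count, InfoStrategy.division, tally, Finset.card_filter, Finset.sum_apply]
  rw [Fintype.sum_prod_type]
  rfl

/-- The sources of `t + 1` periods, from those of the first `t` and those of the last. -/
def extendChoice {t : ℕ} (κ : Fin t × Fin B → Fin K) (c : Fin B → Fin K)
    (p : Fin (t + 1) × Fin B) : Fin K :=
  Fin.lastCases (motive := fun _ => Fin K) (c p.2) (fun r => κ (r, p.2)) p.1

lemma count_extendChoice {t : ℕ} (κ : Fin t × Fin B → Fin K) (c : Fin B → Fin K) :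
    Environment.count (extendChoice κ c) = Environment.count κ + tally c := by
  ext k
  simp only [Environment.count, tally, Pi.add_apply, Finset.card_filter]
  rw [Fintype.sum_prod_type, Fintype.sum_prod_type, Fin.sum_univ_castSucc]
  simp [extendChoice]

/-- The realization numbers and sources of the observations of the first periods. -/
def slot {t : ℕ} (κ : Fin t × Fin B → Fin K) (p : Fin t × Fin B) : ℕ × Fin K :=
  (p.1 * B + p.2, κ p)

lemma slot_injective {t : ℕ} (κ : Fin t × Fin B → Fin K) : Function.Injective (slot κ) := by
  rintro ⟨r, b⟩ ⟨r', b'⟩ h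
  have h1 : (r : ℕ) * B + b = r' * B + b' := congrArg Prod.fst h
  have hB : 0 < B := b.pos
  have hr : (r : ℕ) = r' := by
    have := congrArg (· / B) h1
    simpa [Nat.mul_comm _ B, Nat.mul_add_div hB, Nat.div_eq_of_lt b.isLt,
      Nat.div_eq_of_lt b'.isLt] using this
  have hb : (b : ℕ) = b' := by
    rw [hr] at h1
    omega
  rw [Fin.ext hr, Fin.ext hb]

lemma slot_extendChoice {t : ℕ} (κ : Fin t × Fin B → Fin K) (c : Fin B → Fin K) :
    slot (extendChoice κ c) ∘ Prod.map Fin.castSucc id = slot κ := by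
  ext p <;> simp [slot, extendChoice]

namespace Environment

variable (E : Environment K)

/-- The history in the first `t` periods when the sources `κ` are observed. -/
def histAlong {t : ℕ} (κ : Fin t × Fin B → Fin K) (ω : Sample K) : History B t :=
  fun r b => E.obs (slot κ) ω (r, b)

@[fun_prop]
lemma measurable_histAlong {t : ℕ} (κ : Fin t × Fin B → Fin K) : Measurable (E.histAlong κ) := by
  unfold histAlong obs
  fun_prop

variable (S : InfoStrategy K B)

lemma hist_castSucc (ω : Sample K) (t : ℕ) (r : Fin t) :
    E.hist S ω (t + 1) r.castSucc = E.hist S ω t r := by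
  simp [hist]

lemma hist_last (ω : Sample K) (t : ℕ) (b : Fin B) : E.hist S ω (t + 1) (Fin.last t) b =
    E.signal (t * B + b) (S.choose t (E.hist S ω t) b) ω := by
  simp [hist]

lemma hist_castLE (ω : Sample K) {r t : ℕ} (hrt : r ≤ t) :
    (fun i : Fin r => E.hist S ω t (Fin.castLE hrt i)) = E.hist S ω r := by
  induction t, hrt using Nat.le_induction with
  | base => rfl
  | succ t hrt ih =>
    rw [← ih]
    ext i : 1
    exact E.hist_castSucc S ω t (Fin.castLE hrt i)

lemma chosen_hist (ω : Sample K) (t : ℕ) (p : Fin t × Fin B) :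
    S.chosen (E.hist S ω t) p = S.choose p.1 (E.hist S ω p.1) p.2 := by
  rw [InfoStrategy.chosen, hist_castLE]

lemma hist_apply (ω : Sample K) (t : ℕ) (r : Fin t) (b : Fin B) :
    E.hist S ω t r b = E.signal (r * B + b) (S.choose r (E.hist S ω r) b) ω := by
  rw [← E.hist_last, ← E.hist_castLE S ω (Nat.succ_le_of_lt r.isLt)]
  rfl

lemma hist_eq_histAlong_chosen (ω : Sample K) (t : ℕ) :
    E.hist S ω t = E.histAlong (S.chosen (E.hist S ω t)) ω := by
  ext r b
  rw [hist_apply, histAlong, obs, slot, chosen_hist]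

/-- If `S`, fed with the realizations along `κ`, picks exactly `κ`, then induction on the period
shows that the true history follows `κ`. -/
lemma hist_eq_histAlong_of_chosen_histAlong {ω : Sample K} {t : ℕ} {κ : Fin t × Fin B → Fin K}
    (h : S.chosen (E.histAlong κ ω) = κ) : E.hist S ω t = E.histAlong κ ω := by
  have key : ∀ (r : ℕ) (hr : r < t), E.hist S ω t ⟨r, hr⟩ = E.histAlong κ ω ⟨r, hr⟩ := by
    intro r
    induction r using Nat.strong_induction_on with
    | _ r ih =>
      intro hr
      ext b
      have h1 : E.histAlong κ ω ⟨r, hr⟩ b = E.signal (r * B + b) (κ (⟨r, hr⟩, b)) ω := rfl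
      rw [hist_apply, h1, ← congrFun h (⟨r, hr⟩, b), InfoStrategy.chosen,
        ← E.hist_castLE S ω hr.le]
      congr 3
      ext i : 1
      exact ih i i.isLt _
  ext r : 1
  exact key r r.isLt

/-- Whether `S` follows `κ` can be read off the nonadaptive history along `κ`. This reduces adaptive
sampling to finitely many fixed Gaussian families. -/
lemma chosen_hist_eq_iff {ω : Sample K} {t : ℕ} {κ : Fin t × Fin B → Fin K} :
    S.chosen (E.hist S ω t) = κ ↔ S.chosen (E.histAlong κ ω) = κ := by
  constructor
  · rintro rfl
    rw [← hist_eq_histAlong_chosen]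
  · intro h
    rw [E.hist_eq_histAlong_of_chosen_histAlong S h, h]

lemma chosen_hist_succ (ω : Sample K) (t : ℕ) : S.chosen (E.hist S ω (t + 1)) =
    extendChoice (S.chosen (E.hist S ω t)) (S.choose t (E.hist S ω t)) := by
  ext ⟨r, b⟩ : 1
  rw [chosen_hist]
  refine Fin.lastCases ?_ (fun r => ?_) r
  · simp [extendChoice]
  · simp [extendChoice, chosen_hist]

@[fun_prop]
lemma measurable_hist (t : ℕ) : Measurable fun ω => E.hist S ω t := by
  have h : (fun ω => E.hist S ω t) = fun ω => ∑ κ : Fin t × Fin B → Fin K,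
      if S.chosen (E.histAlong κ ω) = κ then E.histAlong κ ω else 0 := by
    ext ω : 1
    rw [Finset.sum_eq_single (S.chosen (E.hist S ω t))]
    · rw [← hist_eq_histAlong_chosen, if_pos rfl]
    · intro κ _ hκ
      exact if_neg fun h => hκ ((E.chosen_hist_eq_iff S).2 h).symm
    · simp
  rw [h]
  refine Finset.measurable_fun_sum _ fun κ _ => Measurable.ite ?_ (by fun_prop) measurable_const
  exact ((S.measurable_chosen t).comp (E.measurable_histAlong κ)) (measurableSet_singleton κ)

/-- The posterior mean of the payoff-relevant state after a history. -/
def histMean {t : ℕ} (h : History B t) : ℝ := E.postMean (S.chosen h) fun p => h p.1 p.2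

/-- The posterior variance of the payoff-relevant state after a history. -/
def histVar {t : ℕ} (h : History B t) : ℝ := E.stateVar (S.division h)

/-- The posterior variance in the next period, after a history. -/
def nextVar {t : ℕ} (h : History B t) : ℝ := E.stateVar (S.division h + tally (S.choose t h))

@[fun_prop]
lemma measurable_histMean (t : ℕ) : Measurable fun h : History B t => E.histMean S h := by
  have : Measurable fun q : (Fin t × Fin B → Fin K) × History B t =>
      E.postMean q.1 fun p => q.2 p.1 p.2 :=
    measurable_from_prod_countable_right fun κ =>
      (E.measurable_postMean κ).comp (by fun_prop : Measurable fun (h : History B t)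
        (p : Fin t × Fin B) => h p.1 p.2)
  have h : Measurable fun h : History B t => (S.chosen h, h) :=
    (S.measurable_chosen t).prodMk measurable_id
  have e : (fun h : History B t => E.histMean S h) =
      (fun q : (Fin t × Fin B → Fin K) × History B t => E.postMean q.1 fun p => q.2 p.1 p.2) ∘
        fun h => (S.chosen h, h) := rfl
  rw [e]
  exact Measurable.comp this h

@[fun_prop]
lemma measurable_histVar (t : ℕ) : Measurable fun h : History B t => E.histVar S h := by
  simp_rw [histVar, ← InfoStrategy.count_chosen]
  exact (measurable_of_countable fun κ => E.stateVar (count κ)).comp (S.measurable_chosen t)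

@[fun_prop]
lemma measurable_nextVar (t : ℕ) : Measurable fun h : History B t => E.nextVar S h := by
  have h : Measurable fun h : History B t => (S.chosen h, S.choose t h) :=
    (S.measurable_chosen t).prodMk (S.measurable_choose t)
  have h' : Measurable fun q : (Fin t × Fin B → Fin K) × (Fin B → Fin K) =>
    E.stateVar (count q.1 + tally q.2) := measurable_of_countable _
  have e : (fun h : History B t => E.nextVar S h) =
      (fun q : (Fin t × Fin B → Fin K) × (Fin B → Fin K) =>
        E.stateVar (count q.1 + tally q.2)) ∘ fun h => (S.chosen h, S.choose t h) := by
    ext h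
    simp only [Function.comp_apply, nextVar, InfoStrategy.count_chosen]
  rw [e]
  exact Measurable.comp h' h

lemma histVar_hist_succ (ω : Sample K) (t : ℕ) :
    E.histVar S (E.hist S ω (t + 1)) = E.nextVar S (E.hist S ω t) := by
  rw [histVar, nextVar, ← InfoStrategy.count_chosen, ← InfoStrategy.count_chosen,
    chosen_hist_succ, count_extendChoice]

variable [NeZero K]
variable (hw : ∀ θ : EuclideanSpace ℝ (Fin K), θ 0 = ∑ k, E.transformedState k θ)
include hw

/-- Cases are the possible lists of sources; in each, the residual is normal and independent of the
fixed family of observations. -/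
lemma map_hist_state (t : ℕ) : E.P.map (fun ω => (E.hist S ω t, ω.1 0)) =
    condNormal (E.P.map fun ω => E.hist S ω t) (E.histMean S) (E.histVar S) := by
  have h := map_eq_condNormal_of_cases (P := E.P) (X := fun ω => E.hist S ω t)
    (T := fun ω => ω.1 0) (C := fun h => S.chosen h) (m := E.histMean S)
    (v := fun κ => E.stateVar (count κ)) (Y := fun κ => E.histAlong κ)
    (Z := fun κ => E.resid (slot κ)) (by fun_prop) (by fun_prop) (S.measurable_chosen t)
    (by fun_prop) (by fun_prop) (by fun_prop) (fun κ ω => E.chosen_hist_eq_iff S)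
    (fun κ ω h => by subst h; exact E.hist_eq_histAlong_chosen S ω t)
    (fun κ ω h => ?_) (fun κ => ?_) (fun κ => E.map_resid hw (slot_injective κ))
  · simp_rw [InfoStrategy.count_chosen] at h
    exact h
  · have h' := (E.chosen_hist_eq_iff S).1 h
    rw [histMean, h', resid]
    simp [histAlong, slot]
  · exact (E.indepFun_resid_obs hw (slot_injective κ)).comp (φ := id)
      (ψ := fun x r b => x (r, b)) measurable_id (by fun_prop)

/-- The cases now also record the next choice, which the history determines; the revision takes the
place of the residual. -/
lemma map_hist_nextMean (t : ℕ) :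
    E.P.map (fun ω => (E.hist S ω t, E.histMean S (E.hist S ω (t + 1)))) =
      condNormal (E.P.map fun ω => E.hist S ω t) (E.histMean S)
        (fun h => E.histVar S h - E.nextVar S h) := by
  have h := map_eq_condNormal_of_cases (P := E.P) (X := fun ω => E.hist S ω t)
    (T := fun ω => E.histMean S (E.hist S ω (t + 1)))
    (C := fun h => (S.chosen h, S.choose t h)) (m := E.histMean S)
    (v := fun i => E.stateVar (count i.1) - E.stateVar (count i.1 + tally i.2))
    (Y := fun i => E.histAlong i.1)
    (Z := fun i => E.revision (slot i.1) (slot (extendChoice i.1 i.2))) (by fun_prop)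
    (by fun_prop) ((S.measurable_chosen t).prodMk (S.measurable_choose t))
    (by fun_prop) (by fun_prop) (fun i => by unfold revision; fun_prop) (fun i ω => ?_)
    (fun i ω h => ?_) (fun i ω h => ?_) (fun i => ?_) (fun i => ?_)
  · simp_rw [InfoStrategy.count_chosen] at h
    exact h
  · rcases i with ⟨κ, c⟩
    simp only [Prod.mk.injEq]
    constructor
    · rintro ⟨rfl, rfl⟩
      rw [← hist_eq_histAlong_chosen]
      exact ⟨rfl, rfl⟩
    · rintro ⟨h1, h2⟩
      rw [E.hist_eq_histAlong_of_chosen_histAlong S h1]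
      exact ⟨h1, h2⟩
  · subst h
    exact E.hist_eq_histAlong_chosen S ω t
  · subst h
    simp only [revision, ← hist_eq_histAlong_chosen]
    have e1 : E.obs (slot (S.chosen (E.hist S ω t))) ω = fun p => E.hist S ω t p.1 p.2 := by
      ext p
      conv_rhs => rw [hist_eq_histAlong_chosen]
      rfl
    have e2 : E.obs (slot (extendChoice (S.chosen (E.hist S ω t)) (S.choose t (E.hist S ω t)))) ω =
        fun p => E.hist S ω (t + 1) p.1 p.2 := by
      ext p
      conv_rhs => rw [hist_eq_histAlong_chosen, chosen_hist_succ]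
      rfl
    rw [e1, e2]
    simp only [histMean, slot, ← chosen_hist_succ]
    ring
  · have h := E.indepFun_revision_obs hw (slot_injective (extendChoice i.1 i.2))
      (e := Prod.map Fin.castSucc id) ((Fin.castSucc_injective t).prodMap Function.injective_id)
    rw [slot_extendChoice] at h
    exact h.comp (φ := id) (ψ := fun x r b => x (r, b)) measurable_id (by fun_prop)
  · have h := E.map_revision hw (slot_injective (extendChoice i.1 i.2))
      (e := Prod.map Fin.castSucc id) ((Fin.castSucc_injective t).prodMap Function.injective_id)
    rw [slot_extendChoice] at h
    rw [h, ← count_extendChoice]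
    have e : (fun p => (slot (extendChoice i.1 i.2) (Prod.map Fin.castSucc id p)).2) = i.1 := by
      ext p
      exact congrArg (fun x : ℕ × Fin K => (x.2 : ℕ)) (congrFun (slot_extendChoice i.1 i.2) p)
    rw [e]
    rfl

end Environment

end Histories

/-! ### Tools for coupling laws -/

section Coupling

open scoped ENNReal unitInterval

variable {Ω Ω' A D D' H : Type*} [MeasurableSpace Ω] [MeasurableSpace Ω'] [MeasurableSpace A]
  [MeasurableSpace D] [MeasurableSpace D'] [MeasurableSpace H]

instance {ν : Measure H} {m w : H → ℝ} [IsFiniteMeasure ν] : IsFiniteMeasure (condNormal ν m w) := by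
  unfold condNormal
  infer_instance

lemma isProbabilityMeasure_condNormal {ν : Measure H} [IsProbabilityMeasure ν] {m w : H → ℝ}
    (hm : Measurable m) (hw : Measurable w) : IsProbabilityMeasure (condNormal ν m w) :=
  Measure.isProbabilityMeasure_map (by fun_prop)

lemma map_fst_condNormal {ν : Measure H} [SFinite ν] {m w : H → ℝ} (hm : Measurable m)
    (hw : Measurable w) : (condNormal ν m w).map Prod.fst = ν := by
  rw [condNormal, Measure.map_map measurable_fst (by fun_prop)]
  have : (Prod.fst ∘ fun p : H × ℝ => (p.1, m p.1 + √(w p.1) * p.2)) = Prod.fst := rfl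
  rw [this, Measure.map_fst_prod]
  simp

lemma map_prod_eq_condNormal {P : Measure Ω} [IsProbabilityMeasure P] {X : Ω → H}
    (hX : Measurable X) {m w : H → ℝ} (hm : Measurable m) (hw : Measurable w) :
    (P.prod (gaussianReal 0 1)).map (fun p => (X p.1, m (X p.1) + √(w (X p.1)) * p.2)) =
      condNormal (P.map X) m w := by
  have h : (P.map X).prod (gaussianReal 0 1) =
      (P.prod (gaussianReal 0 1)).map (Prod.map X id) := by
    rw [← Measure.map_prod_map _ _ hX measurable_id, Measure.map_id]
  rw [condNormal, h, Measure.map_map (by fun_prop) (by fun_prop)]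
  rfl

/-- Adding an independent normal variable to the second component. -/
lemma map_add_condNormal {ν : Measure H} [IsProbabilityMeasure ν] {m w : H → ℝ} (hm : Measurable m)
    (hw : Measurable w) (hw0 : ∀ h, 0 ≤ w h) {a : ℝ} (ha : 0 ≤ a) :
    ((condNormal ν m w).prod (gaussianReal 0 a.toNNReal)).map (fun q => (q.1.1, q.1.2 + q.2)) =
      condNormal ν m (fun h => w h + a) := by
  have := isProbabilityMeasure_condNormal (ν := ν) hm hw
  have h := map_add_noise_eq_condNormal (P := condNormal ν m w) (X := Prod.fst) (T := Prod.snd)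
    (w' := fun _ => a) measurable_fst measurable_snd hm hw measurable_const (.of_forall hw0)
    (.of_forall fun _ => ha) (by rw [map_fst_condNormal hm hw]; exact Measure.map_id)
  rw [map_fst_condNormal hm hw] at h
  have h2 : (condNormal ν m w).prod (gaussianReal 0 a.toNNReal) =
      ((condNormal ν m w).prod (gaussianReal 0 1)).map (Prod.map id fun z => √a * z) := by
    rw [← Measure.map_prod_map _ _ measurable_id (by fun_prop), Measure.map_id,
      gaussianReal_map_sqrt_mul]
  rw [h2, Measure.map_map (by fun_prop) (by fun_prop)]
  exact h

/-- With constant conditional variance, the deviation from the conditional mean is independent. -/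
lemma map_sub_mean_eq_prod {P : Measure Ω} [IsProbabilityMeasure P] {X : Ω → H} {T : Ω → ℝ}
    (hX : Measurable X) (hT : Measurable T) {m : H → ℝ} (hm : Measurable m) {a : ℝ}
    (h : P.map (fun ω => (X ω, T ω)) = condNormal (P.map X) m fun _ => a) :
    P.map (fun ω => (X ω, T ω - m (X ω))) = (P.map X).prod (gaussianReal 0 a.toNNReal) := by
  have h1 : P.map (fun ω => (X ω, T ω - m (X ω))) =
      (P.map fun ω => (X ω, T ω)).map fun q => (q.1, q.2 - m q.1) := by
    rw [Measure.map_map (by fun_prop) (by fun_prop)]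
    rfl
  rw [h1, h, condNormal, Measure.map_map (by fun_prop) (by fun_prop),
    ← gaussianReal_map_sqrt_mul, ← Measure.map_id (μ := P.map X),
    Measure.map_prod_map _ _ measurable_id (by fun_prop), Measure.map_id]
  congr 1
  ext q <;> simp

/-- Combining two independent pairs. -/
lemma map_prod_of_indep {P : Measure Ω} [IsProbabilityMeasure P] {Q : Measure Ω'}
    [IsProbabilityMeasure Q] {X : Ω → A} {e : Ω → ℝ} {V : Ω' → D} {V' : Ω' → D'}
    (hX : Measurable X) (he : Measurable e) (hV : Measurable V) (hV' : Measurable V')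
    {ρ : Measure ℝ} [IsProbabilityMeasure ρ] {τ : Measure D'} [IsProbabilityMeasure τ]
    (hP : P.map (fun ω => (X ω, e ω)) = (P.map X).prod ρ)
    (hQ : Q.map (fun ω => (V ω, V' ω)) = (Q.map V).prod τ) {φ : A × D → H} (hφ : Measurable φ) :
    (P.prod Q).map (fun p => ((φ (X p.1, V p.2), e p.1), V' p.2)) =
      (((P.prod Q).map fun p => φ (X p.1, V p.2)).prod ρ).prod τ := by
  refine Measure.ext_of_lintegral _ fun g hg => ?_
  have hG1 : Measurable fun q : (A × ℝ) × D => ∫⁻ d', g ((φ (q.1.1, q.2), q.1.2), d') ∂τ :=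
    Measurable.lintegral_prod_right' (f := fun q : ((A × ℝ) × D) × D' =>
      g ((φ (q.1.1.1, q.1.2), q.1.1.2), q.2)) (by fun_prop)
  have hG2 : Measurable fun q : A × ℝ => ∫⁻ d, ∫⁻ d', g ((φ (q.1, d), q.2), d') ∂τ ∂(Q.map V) :=
    hG1.lintegral_prod_right'
  have hG3 : Measurable fun q : H × ℝ => ∫⁻ d', g (q, d') ∂τ := hg.lintegral_prod_right'
  have hG4 : Measurable fun y : H => ∫⁻ x, ∫⁻ d', g ((y, x), d') ∂τ ∂ρ :=
    hG3.lintegral_prod_right'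
  have : IsProbabilityMeasure (Q.map V) := Measure.isProbabilityMeasure_map hV.aemeasurable
  have : IsProbabilityMeasure (P.map X) := Measure.isProbabilityMeasure_map hX.aemeasurable
  calc ∫⁻ y, g y ∂((P.prod Q).map fun p => ((φ (X p.1, V p.2), e p.1), V' p.2))
      = ∫⁻ ω, ∫⁻ ω', g ((φ (X ω, V ω'), e ω), V' ω') ∂Q ∂P := by
        rw [lintegral_map hg (by fun_prop), lintegral_prod _ (by fun_prop)]
    _ = ∫⁻ ω, ∫⁻ d, ∫⁻ d', g ((φ (X ω, d), e ω), d') ∂τ ∂(Q.map V) ∂P := by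
        refine lintegral_congr fun ω => ?_
        rw [← lintegral_map (μ := Q) (g := fun ω' => (V ω', V' ω'))
          (f := fun q : D × D' => g ((φ (X ω, q.1), e ω), q.2)) (by fun_prop) (by fun_prop), hQ,
          lintegral_prod _ (by fun_prop)]
    _ = ∫⁻ x, ∫⁻ y, ∫⁻ d, ∫⁻ d', g ((φ (x, d), y), d') ∂τ ∂(Q.map V) ∂ρ ∂(P.map X) := by
        rw [← lintegral_map (μ := P) (g := fun ω => (X ω, e ω)) hG2 (by fun_prop), hP,
          lintegral_prod _ hG2.aemeasurable]
    _ = ∫⁻ x, ∫⁻ d, ∫⁻ y, ∫⁻ d', g ((φ (x, d), y), d') ∂τ ∂ρ ∂(Q.map V) ∂(P.map X) := by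
        refine lintegral_congr fun x => ?_
        rw [lintegral_lintegral_swap]
        exact (hG1.comp (by fun_prop : Measurable fun q : ℝ × D => ((x, q.1), q.2))).aemeasurable
    _ = ∫⁻ ω, ∫⁻ ω', ∫⁻ y, ∫⁻ d', g ((φ (X ω, V ω'), y), d') ∂τ ∂ρ ∂Q ∂P := by
        have hG5 : Measurable fun q : A × D => ∫⁻ y, ∫⁻ d', g ((φ q, y), d') ∂τ ∂ρ :=
          hG4.comp hφ
        rw [lintegral_map hG5.lintegral_prod_right' hX]
        refine lintegral_congr fun ω => ?_
        exact lintegral_map (hG5.comp measurable_prodMk_left) hV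
    _ = _ := by
        rw [lintegral_prod _ hg.aemeasurable, lintegral_prod _ hG3.aemeasurable,
          lintegral_map hG4 (by fun_prop), lintegral_prod]
        exact (hG4.comp (by fun_prop)).aemeasurable

/-- Functional representation of a conditional distribution. -/
lemma exists_measurable_map_eq_of_condDistrib [StandardBorelSpace D] [Nonempty D] {P : Measure Ω}
    [IsProbabilityMeasure P] {X : Ω → A} {V : Ω → D} (hX : Measurable X) (hV : Measurable V) :
    ∃ F : A → I → D, Measurable (Function.uncurry F) ∧
      ((P.map X).prod (volume : Measure I)).map (fun q => (q.1, F q.1 q.2)) =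
        P.map fun ω => (X ω, V ω) := by
  obtain ⟨F, hF, h⟩ := (condDistrib V X P).exists_measurable_map_eq_unitInterval
  refine ⟨F, hF, ?_⟩
  have : IsProbabilityMeasure (P.map X) := Measure.isProbabilityMeasure_map hX.aemeasurable
  have hF' : Measurable fun q : A × I => F q.1 q.2 := hF
  rw [← compProd_map_condDistrib hV.aemeasurable]
  refine Measure.ext_of_lintegral _ fun g hg => ?_
  rw [lintegral_map hg (by fun_prop), lintegral_prod _ (by fun_prop),
    Measure.lintegral_compProd hg]
  refine lintegral_congr fun a => ?_
  rw [← h, lintegral_map (by fun_prop) (hF.of_uncurry_left)]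

/-- The law of a sequence jointly with a real variable is determined by its initial segments. -/
lemma map_seq_prodMk_eq {P : Measure Ω} [IsProbabilityMeasure P] {Q : Measure Ω'}
    [IsProbabilityMeasure Q] {X : Ω → ℕ → D} {Y : Ω' → ℕ → D} {T : Ω → ℝ} {T' : Ω' → ℝ}
    (hX : Measurable X) (hY : Measurable Y) (hT : Measurable T) (hT' : Measurable T')
    (h : ∀ t : ℕ, P.map (fun ω => ((fun r : Fin t => X ω r), T ω)) =
      Q.map (fun ω => ((fun r : Fin t => Y ω r), T' ω))) :
    P.map (fun ω => (X ω, T ω)) = Q.map (fun ω => (Y ω, T' ω)) := by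
  -- Copying the real variable into every coordinate leaves a single sequence, to which uniqueness
  -- of projective limits applies.
  have key : P.map (fun ω (r : ℕ) => (X ω r, T ω)) = Q.map (fun ω (r : ℕ) => (Y ω r, T' ω)) := by
    have hP := isProjectiveLimit_map (P := P) (X := fun (r : ℕ) ω => (X ω r, T ω)) (by fun_prop)
    have hQ := isProjectiveLimit_map (P := Q) (X := fun (r : ℕ) ω => (Y ω r, T' ω)) (by fun_prop)
    refine hP.unique ?_
    convert hQ using 2 with J
    obtain ⟨t, ht⟩ : ∃ t, ∀ r ∈ J, r < t :=
      ⟨J.sup id + 1, fun r hr => Nat.lt_succ_of_le (Finset.le_sup (f := id) hr)⟩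
    have := congrArg (Measure.map fun q : (Fin t → D) × ℝ =>
      fun r : J => (q.1 ⟨r, ht r r.2⟩, q.2)) (h t)
    rw [Measure.map_map (by fun_prop) (by fun_prop),
      Measure.map_map (by fun_prop) (by fun_prop)] at this
    exact this
  have := congrArg (Measure.map fun z : ℕ → D × ℝ => ((fun r => (z r).1), (z 0).2)) key
  rw [Measure.map_map (by fun_prop) (by fun_prop), Measure.map_map (by fun_prop) (by fun_prop)]
    at this
  exact this

end Coupling

/-! ### Simulated histories and their randomization -/

section Simulation

open scoped unitInterval

variable {K B : ℕ}

lemma measurable_snoc (t : ℕ) : Measurable fun q : History B t × (Fin B → ℝ) =>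
    (Fin.snoc (α := fun _ => Fin B → ℝ) q.1 q.2 : History B (t + 1)) := by
  refine measurable_pi_iff.2 fun r => ?_
  refine Fin.lastCases ?_ (fun r => ?_) r
  · simpa using measurable_snd
  · simp only [Fin.snoc_castSucc]
    exact (measurable_pi_apply r).comp measurable_fst

/-- A history simulated from the statistics `y` of an actual one and from the randomization `u`. -/
def simulate (y : (t : ℕ) → History B t → ℝ) (F : (t : ℕ) → History B t × ℝ → I → Fin B → ℝ) :
    (t : ℕ) → History B t → (ℕ → I) → History B t
  | 0, _, _ => Fin.elim0
  | t + 1, h, u => Fin.snoc (α := fun _ => Fin B → ℝ)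
      (simulate y F t (fun r => h r.castSucc) u)
      (F t (simulate y F t (fun r => h r.castSucc) u, y (t + 1) h) (u t))

variable {y : (t : ℕ) → History B t → ℝ} {F : (t : ℕ) → History B t × ℝ → I → Fin B → ℝ}

lemma measurable_simulate (hy : ∀ t, Measurable (y t))
    (hF : ∀ t, Measurable (Function.uncurry (F t))) (t : ℕ) :
    Measurable fun q : History B t × (ℕ → I) => simulate y F t q.1 q.2 := by
  induction t with
  | zero => exact measurable_const
  | succ t ih =>
    have h1 : Measurable fun q : History B (t + 1) × (ℕ → I) =>
        simulate y F t (fun r => q.1 r.castSucc) q.2 :=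
      ih.comp (f := fun q : History B (t + 1) × (ℕ → I) =>
        ((fun r : Fin t => q.1 r.castSucc : History B t), q.2)) (by fun_prop)
    have h2 : Measurable fun q : History B (t + 1) × (ℕ → I) =>
        F t (simulate y F t (fun r => q.1 r.castSucc) q.2, y (t + 1) q.1) (q.2 t) :=
      (hF t).comp ((h1.prodMk ((hy (t + 1)).comp measurable_fst)).prodMk
        ((measurable_pi_apply t).comp measurable_snd))
    exact (measurable_snoc t).comp (h1.prodMk h2)

/-- The first `t` periods use only `u 0, …, u (t - 1)`, which leaves `u t` as fresh randomness for
the next one. -/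
lemma simulate_congr (t : ℕ) (h : History B t) {u u' : ℕ → I} (huu : ∀ r < t, u r = u' r) :
    simulate y F t h u = simulate y F t h u' := by
  induction t with
  | zero => rfl
  | succ t ih =>
    simp only [simulate]
    rw [ih _ fun r hr => huu r (Nat.lt_succ_of_lt hr), huu t (Nat.lt_succ_self t)]

lemma simulate_castSucc (t : ℕ) (h : History B (t + 1)) (u : ℕ → I) (r : Fin t) :
    simulate y F (t + 1) h u r.castSucc = simulate y F t (fun r => h r.castSucc) u r := by
  simp [simulate]

/-- The law of an independent sequence of uniform variables. -/
def unifSeq : Measure (ℕ → I) := Measure.infinitePi fun _ => (volume : Measure I)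

instance : IsProbabilityMeasure unifSeq := by
  unfold unifSeq
  infer_instance

/-- The sequence `u` with its terms from the `t`-th on removed. -/
def truncate (t : ℕ) (u : ℕ → I) (r : ℕ) : I := if r < t then u r else 0

lemma measurable_truncate (t : ℕ) : Measurable (truncate t) := by
  refine measurable_pi_iff.2 fun r => ?_
  by_cases h : r < t
  · simpa [truncate, h] using measurable_pi_apply r
  · simp [truncate, h]

lemma map_truncate_eval (t : ℕ) : unifSeq.map (fun u => (truncate t u, u t)) =
    (unifSeq.map (truncate t)).prod volume := by
  have hi : iIndepFun (fun (r : ℕ) (u : ℕ → I) => u r) unifSeq :=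
    iIndepFun_infinitePi (X := fun _ x => x) (fun _ => measurable_id)
  have h1 := hi.indepFun_finset (Finset.range t) {t} (by simp) (fun r => measurable_pi_apply r)
  have hφ : Measurable fun (x : Finset.range t → I) (r : ℕ) =>
      if h : r < t then x ⟨r, Finset.mem_range.2 h⟩ else 0 := measurable_pi_iff.2 fun r => by
    by_cases h : r < t
    · simpa [h] using measurable_pi_apply _
    · simp [h]
  have hψ : Measurable fun x : ({t} : Finset ℕ) → I => x ⟨t, Finset.mem_singleton_self t⟩ :=
    measurable_pi_apply _
  have h2 := h1.comp hφ hψ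
  have h3 : IndepFun (truncate t) (fun u : ℕ → I => u t) unifSeq := h2
  rw [(indepFun_iff_map_prod_eq_prod_map_map (measurable_truncate t).aemeasurable
    (measurable_pi_apply t).aemeasurable).1 h3]
  congr 1
  exact Measure.infinitePi_map_eval _ t

end Simulation

/-! ### Simulating a strategy from a more informative one -/

namespace Environment

open scoped unitInterval

variable {K B : ℕ} (E : Environment K)

lemma sum_division (S : InfoStrategy K B) {t : ℕ} (h : History B t) :
    ∑ k, S.division h k = t * B := by
  rw [← InfoStrategy.count_chosen]
  simp only [count]
  rw [Finset.sum_card_fiberwise_eq_card_filter]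
  simp

lemma sum_tally (c : Fin B → Fin K) : ∑ k, tally c k = B := by
  simp only [tally]
  rw [Finset.sum_card_fiberwise_eq_card_filter]
  simp

variable [NeZero K]
variable (hw : ∀ θ : EuclideanSpace ℝ (Fin K), θ 0 = ∑ k, E.transformedState k θ)
include hw

/-- The difference is the variance of a revision. -/
lemma nextVar_le_histVar (S : InfoStrategy K B) {t : ℕ} (h : History B t) :
    E.nextVar S h ≤ E.histVar S h := by
  have h1 := E.variance_revision hw (slot_injective (extendChoice (S.chosen h) (S.choose t h)))
    (e := Prod.map Fin.castSucc id) ((Fin.castSucc_injective t).prodMap Function.injective_id)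
  have e1 : (fun i => (slot (extendChoice (S.chosen h) (S.choose t h))
      (Prod.map Fin.castSucc id i)).2) = S.chosen h :=
    funext fun p => congrArg Prod.snd
      (congrFun (slot_extendChoice (S.chosen h) (S.choose t h)) p)
  have e2 : (fun i => (slot (extendChoice (S.chosen h) (S.choose t h)) i).2) =
    extendChoice (S.chosen h) (S.choose t h) := rfl
  have h2 := variance_nonneg (E.revision (slot (extendChoice (S.chosen h) (S.choose t h)) ∘
    Prod.map Fin.castSucc id) (slot (extendChoice (S.chosen h) (S.choose t h)))) E.P
  rw [h1, e1, e2, count_extendChoice, InfoStrategy.count_chosen] at h2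
  rw [nextVar, histVar]
  linarith

lemma histVar_nonneg (S : InfoStrategy K B) {t : ℕ} (h : History B t) : 0 ≤ E.histVar S h := by
  have h1 := E.stateVar_count_nonneg hw (slot_injective (S.chosen h))
  have e : (fun i => (slot (S.chosen h) i).2) = S.chosen h := rfl
  rwa [e, InfoStrategy.count_chosen] at h1

/-- A strategy with deterministic posterior variances `v` that are never above those of the
strategy `S` allows to simulate the histories of `S`, jointly with the payoff-relevant state. -/
theorem exists_simulation (S S' : InfoStrategy K B) {v : ℕ → ℝ}
    (hv : ∀ t (h : History B t), E.histVar S' h = v t)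
    (hv' : ∀ t (h : History B t), E.nextVar S' h = v (t + 1))
    (hdom : ∀ t (q : Fin K → ℕ), ∑ k, q k = t * B → v t ≤ E.stateVar q) :
    ∃ G : (t : ℕ) → History B t → (ℕ → I) → History B t,
      (∀ t, Measurable fun q : History B t × (ℕ → I) => G t q.1 q.2) ∧
      (∀ t h u (r : Fin t), G (t + 1) h u r.castSucc = G t (fun r => h r.castSucc) u r) ∧
      ∀ t, (E.P.prod unifSeq).map (fun p => (G t (E.hist S' p.1 t) p.2, p.1.1 0)) =
        E.P.map fun ω => (E.hist S ω t, ω.1 0) := by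
  have hprob : ∀ t, IsProbabilityMeasure (E.P.map fun ω => E.hist S ω t) := fun t =>
    Measure.isProbabilityMeasure_map (E.measurable_hist S t).aemeasurable
  have hdom0 : ∀ t (h : History B t), 0 ≤ E.histVar S h - v t := fun t h =>
    sub_nonneg.2 (hdom t _ (sum_division S h))
  have hdom1 : ∀ t (h : History B t), 0 ≤ E.nextVar S h - v (t + 1) := fun t h => by
    refine sub_nonneg.2 (hdom _ _ ?_)
    simp only [Pi.add_apply, Finset.sum_add_distrib, sum_division, sum_tally]
    ring
  have hvmono : ∀ t, 0 ≤ v t - v (t + 1) := fun t => by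
    have := E.nextVar_le_histVar hw S' (fun _ _ => 0 : History B t)
    rw [hv, hv'] at this
    linarith
  have hv0 : ∀ t, 0 ≤ v t := fun t => by
    have := E.histVar_nonneg hw S' (fun _ _ => 0 : History B t)
    rwa [hv] at this
  -- the statistic of the next period, attached to the histories of `S`
  set Y : (t : ℕ) → Sample K × ℝ → ℝ := fun t p => E.histMean S (E.hist S p.1 t) +
    √(E.histVar S (E.hist S p.1 t) - v t) * p.2 with hY
  have hYm : ∀ t, Measurable (Y t) := fun t => by
    rw [hY]
    fun_prop
  -- Seen from period `t`, the revision has variance `histVar - nextVar` and the blur `nextVar - v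
  -- (t + 1)`. The latter is known at `t`, because the next posterior variance does not depend on
  -- the next realizations.
  have hlift : ∀ t, (E.P.prod (gaussianReal 0 1)).map (fun p => (E.hist S p.1 t, Y (t + 1) p)) =
      condNormal (E.P.map fun ω => E.hist S ω t) (E.histMean S)
        fun h => E.histVar S h - v (t + 1) := fun t => by
    have hT : Measurable fun ω => E.histMean S (E.hist S ω (t + 1)) := by fun_prop
    have hW : Measurable fun h : History B t => E.histVar S h - E.nextVar S h := by fun_prop
    have hW' : Measurable fun h : History B t => E.nextVar S h - v (t + 1) := by fun_prop
    have h0 : ∀ h : History B t, 0 ≤ E.histVar S h - E.nextVar S h := fun h =>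
      sub_nonneg.2 (E.nextVar_le_histVar hw S h)
    have h := map_add_noise_eq_condNormal (P := E.P) (E.measurable_hist S t) hT
      (E.measurable_histMean S t) hW hW' (.of_forall h0) (.of_forall (hdom1 t))
      (E.map_hist_nextMean S hw t)
    simp_rw [hY, histVar_hist_succ]
    rw [h]
    congr 1
    ext h
    simp
  -- `F t` draws the realizations of the next period under `S` given its history so far and the next
  -- blurred mean.
  choose F hF hFlaw using fun t => exists_measurable_map_eq_of_condDistrib
    (P := E.P.prod (gaussianReal 0 1)) (X := fun p => (E.hist S p.1 t, Y (t + 1) p))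
    (V := fun p => E.hist S p.1 (t + 1) (Fin.last t))
    (by have := hYm (t + 1); fun_prop) (by fun_prop)
  set y : (t : ℕ) → History B t → ℝ := fun t h => E.histMean S' h with hy
  have hym : ∀ t, Measurable (y t) := fun t => E.measurable_histMean S' t
  have hGm := measurable_simulate hym hF
  have hstate : ∀ t, E.P.map (fun ω => (E.hist S' ω t, ω.1 0 - y t (E.hist S' ω t))) =
      (E.P.map fun ω => E.hist S' ω t).prod (gaussianReal 0 (v t).toNNReal) := fun t => by
    refine map_sub_mean_eq_prod (by fun_prop) (by fun_prop) (hym t) ?_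
    rw [E.map_hist_state S' hw t]
    congr 1
    exact funext (hv t)
  have hinc : ∀ t, E.P.map (fun ω =>
        (E.hist S' ω t, y (t + 1) (E.hist S' ω (t + 1)) - y t (E.hist S' ω t))) =
      (E.P.map fun ω => E.hist S' ω t).prod (gaussianReal 0 (v t - v (t + 1)).toNNReal) :=
    fun t => by
      have hT : Measurable fun ω => y (t + 1) (E.hist S' ω (t + 1)) :=
        (hym _).comp (E.measurable_hist S' (t + 1))
      refine map_sub_mean_eq_prod (by fun_prop) hT (hym t) ?_
      rw [E.map_hist_nextMean S' hw t]
      congr 1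
      ext h
      rw [hv, hv']
  have htrunc : ∀ t (h : History B t) u, simulate y F t h (truncate t u) = simulate y F t h u :=
    fun t h u => simulate_congr t h fun r hr => if_pos hr
  have hφ : ∀ t, Measurable fun q : History B t × (ℕ → I) => (simulate y F t q.1 q.2, y t q.1) :=
    fun t => (hGm t).prodMk ((hym t).comp measurable_fst)
  -- adding the next innovation, and the next randomization
  have hstep : ∀ t {e : Sample K → ℝ} {a : ℝ}, 0 ≤ a → Measurable e →
      E.P.map (fun ω => (E.hist S' ω t, e ω)) =
        (E.P.map fun ω => E.hist S' ω t).prod (gaussianReal 0 a.toNNReal) →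
      (E.P.prod unifSeq).map (fun p =>
        (simulate y F t (E.hist S' p.1 t) p.2, y t (E.hist S' p.1 t))) =
        condNormal (E.P.map fun ω => E.hist S ω t) (E.histMean S)
          (fun h => E.histVar S h - v t) →
      (E.P.prod unifSeq).map (fun p =>
        ((simulate y F t (E.hist S' p.1 t) p.2, y t (E.hist S' p.1 t) + e p.1), p.2 t)) =
        (condNormal (E.P.map fun ω => E.hist S ω t) (E.histMean S)
          (fun h => E.histVar S h - v t + a)).prod volume := by
    intro t e a ha he hPe hinv
    have h := map_prod_of_indep (P := E.P) (Q := unifSeq) (E.measurable_hist S' t) he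
      (measurable_truncate t) (measurable_pi_apply t) hPe (map_truncate_eval t) (hφ t)
    simp only [htrunc] at h
    rw [hinv] at h
    have hwm : Measurable fun h : History B t => E.histVar S h - v t := by fun_prop
    have := isProbabilityMeasure_condNormal (ν := E.P.map fun ω => E.hist S ω t)
      (E.measurable_histMean S t) hwm
    have h' := congrArg (Measure.map (Prod.map (fun q : (History B t × ℝ) × ℝ =>
      (q.1.1, q.1.2 + q.2)) (id : I → I))) h
    have hm1 : Measurable fun p : Sample K × (ℕ → I) =>
        (((simulate y F t (E.hist S' p.1 t) p.2, y t (E.hist S' p.1 t)), e p.1), p.2 t) :=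
      (((hφ t).comp (f := fun p : Sample K × (ℕ → I) => (E.hist S' p.1 t, p.2))
        (by fun_prop)).prodMk (he.comp measurable_fst)).prodMk (by fun_prop)
    rw [← Measure.map_prod_map _ _ (by fun_prop) measurable_id, Measure.map_id,
      map_add_condNormal (E.measurable_histMean S t) hwm (hdom0 t) ha,
      Measure.map_map (by fun_prop) hm1] at h'
    exact h'
  -- The invariant: the simulated history and the actual posterior mean are distributed like the
  -- history of `S` and its blurred mean `Y t`. Only the law at each single date matters, so the one
  -- normal variable shared by all `Y t` does no harm.
  have hinv : ∀ t, (E.P.prod unifSeq).map (fun p =>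
        (simulate y F t (E.hist S' p.1 t) p.2, y t (E.hist S' p.1 t))) =
        condNormal (E.P.map fun ω => E.hist S ω t) (E.histMean S)
          (fun h => E.histVar S h - v t) := by
    intro t
    induction t with
    | zero =>
      rw [← map_prod_eq_condNormal (E.measurable_hist S 0) (E.measurable_histMean S 0)
        (by fun_prop)]
      have hc : ∀ h h' : History B 0, h = h' := fun h h' => Subsingleton.elim h h'
      set h0 : History B 0 := Fin.elim0 with hh0
      -- Before any observation both strategies have the prior variance, so there is no blur and
      -- both laws are the same point mass.
      have hvar : E.histVar S h0 - v 0 = 0 := by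
        rw [← hv 0 h0, histVar, histVar]
        simp [InfoStrategy.division]
      have hmean : y 0 h0 = E.histMean S h0 := by
        simp [hy, histMean, postMean]
      have e1 : (fun p : Sample K × (ℕ → I) =>
          (simulate y F 0 (E.hist S' p.1 0) p.2, y 0 (E.hist S' p.1 0))) =
          fun _ => (h0, E.histMean S h0) := by
        ext p : 1
        rw [hc (E.hist S' p.1 0) h0, hmean, hc (simulate y F 0 h0 p.2) h0]
      have e2 : (fun p : Sample K × ℝ => (E.hist S p.1 0, E.histMean S (E.hist S p.1 0) +
          √(E.histVar S (E.hist S p.1 0) - v 0) * p.2)) = fun _ => (h0, E.histMean S h0) := by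
        ext p : 1
        rw [hc (E.hist S p.1 0) h0, hvar]
        simp
      rw [e1, e2, Measure.map_const, Measure.map_const]
      simp
    | succ t ih =>
      have h := hstep t (hvmono t) (e := fun ω =>
        y (t + 1) (E.hist S' ω (t + 1)) - y t (E.hist S' ω t))
        (((hym _).comp (by fun_prop)).sub ((hym _).comp (by fun_prop))) (hinc t) ih
      simp only [add_sub_cancel, sub_add_sub_cancel] at h
      -- The actual innovation has shrunk the blur from `v t` to `v (t + 1)`. The law is now that of
      -- the old history of `S` with its next blurred mean, which is the input `F t` expects.
      rw [← hlift] at h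
      have hF' : Measurable fun q : (History B t × ℝ) × I => F t q.1 q.2 := hF t
      have h2 := congrArg (Measure.map fun q : (History B t × ℝ) × I => (q.1, F t q.1 q.2)) h
      rw [hFlaw t] at h2
      have hsn := measurable_snoc (B := B) t
      have h3 := congrArg (Measure.map fun q : (History B t × ℝ) × (Fin B → ℝ) =>
        ((Fin.snoc (α := fun _ => Fin B → ℝ) q.1.1 q.2 : History B (t + 1)), q.1.2)) h2
      have hsn' : Measurable fun q : (History B t × ℝ) × (Fin B → ℝ) =>
          ((Fin.snoc (α := fun _ => Fin B → ℝ) q.1.1 q.2 : History B (t + 1)), q.1.2) :=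
        (hsn.comp (f := fun q : (History B t × ℝ) × (Fin B → ℝ) => (q.1.1, q.2))
          (by fun_prop)).prodMk (by fun_prop)
      have hYm' := hYm (t + 1)
      have hm1 : Measurable fun p : Sample K × (ℕ → I) =>
          ((simulate y F t (E.hist S' p.1 t) p.2, y (t + 1) (E.hist S' p.1 (t + 1))), p.2 t) :=
        (((hGm t).comp (f := fun p : Sample K × (ℕ → I) => (E.hist S' p.1 t, p.2))
          (by fun_prop)).prodMk ((hym (t + 1)).comp (by fun_prop))).prodMk (by fun_prop)
      rw [Measure.map_map (by fun_prop) hm1, Measure.map_map hsn' (by fun_prop),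
        Measure.map_map hsn' (by fun_prop)] at h3
      rw [← map_prod_eq_condNormal (E.measurable_hist S (t + 1)) (E.measurable_histMean S (t + 1))
        (by fun_prop)]
      have e1 : ∀ ω, (fun r : Fin t => E.hist S' ω (t + 1) r.castSucc) = E.hist S' ω t :=
        fun ω => funext fun r => E.hist_castSucc S' ω t r
      have e2 : ∀ ω, (Fin.snoc (α := fun _ => Fin B → ℝ) (E.hist S ω t)
          (E.hist S ω (t + 1) (Fin.last t)) : History B (t + 1)) = E.hist S ω (t + 1) :=
        fun ω => by simp [hist]
      simp only [simulate, e1]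
      simp only [Function.comp_def, e2] at h3
      exact h3
  refine ⟨simulate y F, hGm, simulate_castSucc, fun t => ?_⟩
  -- Adding the remaining uncertainty, of variance `v t`, turns the posterior mean into the state
  -- and cancels the blur term `- v t`.
  have h := hstep t (hv0 t) (e := fun ω => ω.1 0 - y t (E.hist S' ω t))
    (by have := hym t; fun_prop) (hstate t) (hinv t)
  simp only [add_sub_cancel, sub_add_cancel] at h
  have h' := congrArg (Measure.map Prod.fst) h
  have hm1 : Measurable fun p : Sample K × (ℕ → I) =>
      ((simulate y F t (E.hist S' p.1 t) p.2, p.1.1 0), p.2 t) :=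
    (((hGm t).comp (f := fun p : Sample K × (ℕ → I) => (E.hist S' p.1 t, p.2))
      (by fun_prop)).prodMk (by fun_prop)).prodMk (by fun_prop)
  rw [Measure.map_map measurable_fst hm1, Measure.map_fst_prod] at h'
  simp only [measure_univ, one_smul] at h'
  rw [E.map_hist_state S hw t]
  exact h'

end Environment

/-! ### Divisions and history-independent strategies -/

section Divisions

variable {K : ℕ}

lemma exists_tally_eq {B : ℕ} (d : Fin K → ℕ) (hd : ∑ k, d k = B) :
    ∃ c : Fin B → Fin K, tally c = d := by
  have e : Fin B ≃ (k : Fin K) × Fin (d k) :=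
    (Fintype.equivFinOfCardEq (by simpa using hd)).symm
  refine ⟨fun b => (e b).1, ?_⟩
  ext k
  have h : (Finset.univ.filter fun b => (e b).1 = k).card = Fintype.card {b // (e b).1 = k} :=
    (Fintype.card_subtype _).symm
  rw [tally, h, Fintype.card_congr (e.subtypeEquiv (q := fun p => p.1 = k) fun b => Iff.rfl),
    Fintype.card_congr (Equiv.sigmaSubtype k)]
  simp

lemma exists_sum_eq_isMin [NeZero K] (f : (Fin K → ℕ) → ℝ) (t : ℕ) :
    ∃ n : Fin K → ℕ, ∑ k, n k = t ∧ ∀ q : Fin K → ℕ, ∑ k, q k = t → f n ≤ f q := by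
  obtain ⟨n, hn, hmin⟩ := (Finset.piAntidiag (Finset.univ : Finset (Fin K)) t).exists_min_image f
    ⟨Pi.single 0 t, by simp [Finset.mem_piAntidiag]⟩
  simp only [Finset.mem_piAntidiag, Finset.mem_univ, implies_true, and_true] at hn hmin
  exact ⟨n, hn, hmin⟩

/-- The strategy that observes the sources `c t` in period `t`, whatever the history. -/
def fixedStrategy {B : ℕ} (c : ℕ → Fin B → Fin K) : InfoStrategy K B where
  choose t _ := c t
  measurable_choose _ := measurable_const

lemma division_fixedStrategy {B : ℕ} {c : ℕ → Fin B → Fin K} {n : ℕ → Fin K → ℕ} (h0 : n 0 = 0)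
    (hc : ∀ t, n (t + 1) = n t + tally (c t)) {t : ℕ} (h : History B t) :
    (fixedStrategy c).division h = n t := by
  simp only [InfoStrategy.division, fixedStrategy]
  rw [Fin.sum_univ_eq_sum_range fun s => tally (c s)]
  clear h
  induction t with
  | zero => simp [h0]
  | succ t ih => rw [Finset.sum_range_succ, ih, hc]

end Divisions

/-! ### From simulation to payoffs, and the conclusion -/

namespace Environment

open scoped unitInterval

variable {K B : ℕ} (E : Environment K) [NeZero K]

/-- Histories that can be simulated can be exploited: any payoff can be matched or improved. -/
lemma exists_payoff_ge_of_simulation {S S' : InfoStrategy K B}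
    {G : (t : ℕ) → History B t → (ℕ → I) → History B t}
    (hG : ∀ t, Measurable fun q : History B t × (ℕ → I) => G t q.1 q.2)
    (hGs : ∀ t h u (r : Fin t), G (t + 1) h u r.castSucc = G t (fun r => h r.castSucc) u r)
    (hlaw : ∀ t, (E.P.prod unifSeq).map (fun p => (G t (E.hist S' p.1 t) p.2, p.1.1 0)) =
        E.P.map fun ω => (E.hist S ω t, ω.1 0))
    (D : DecisionProblem.{u}) (A : DecisionStrategy D B) (hA : E.FinitePayoff D S A) :
    ∃ A' : DecisionStrategy D B, E.FinitePayoff D S' A' ∧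
      E.expectedPayoff D S A ≤ E.expectedPayoff D S' A' := by
  have hlast : ∀ ω (t : ℕ) (r : Fin t), E.hist S ω t r = E.hist S ω (r + 1) (Fin.last r) := by
    intro ω t r
    rw [← E.hist_castLE S ω (Nat.succ_le_of_lt r.isLt)]
    rfl
  have hGlast : ∀ ω u (t : ℕ) (r : Fin t), G t (E.hist S' ω t) u r =
      G (r + 1) (E.hist S' ω (r + 1)) u (Fin.last r) := by
    intro ω u t
    induction t with
    | zero => exact fun r => r.elim0
    | succ t ih =>
      intro r
      refine Fin.lastCases rfl (fun r => ?_) r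
      rw [hGs, funext fun r => E.hist_castSucc S' ω t r, ih]
      rfl
  set X : Sample K → ℕ → Fin B → ℝ := fun ω r => E.hist S ω (r + 1) (Fin.last r) with hX
  set Y : Sample K × (ℕ → I) → ℕ → Fin B → ℝ := fun p r =>
    G (r + 1) (E.hist S' p.1 (r + 1)) p.2 (Fin.last r) with hY
  have hXm : Measurable X := by
    rw [hX]
    fun_prop
  have hGm : ∀ t, Measurable fun p : Sample K × (ℕ → I) => G t (E.hist S' p.1 t) p.2 := fun t =>
    (hG t).comp (f := fun p : Sample K × (ℕ → I) => (E.hist S' p.1 t, p.2)) (by fun_prop)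
  have hYm : Measurable Y := measurable_pi_iff.2 fun r =>
    (measurable_pi_apply (Fin.last r)).comp (hGm (r + 1))
  have heq : (E.P.prod unifSeq).map (fun p => (Y p, p.1.1 0)) = E.P.map fun ω => (X ω, ω.1 0) := by
    refine map_seq_prodMk_eq hYm hXm (by fun_prop) (by fun_prop) fun t => ?_
    have h := hlaw t
    rw [show (fun p : Sample K × (ℕ → I) => (G t (E.hist S' p.1 t) p.2, p.1.1 0)) =
        fun p => ((fun r : Fin t => Y p r), p.1.1 0) from
      funext fun p => Prod.ext (funext fun r => hGlast p.1 p.2 t r) rfl,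
      show (fun ω : Sample K => (E.hist S ω t, ω.1 0)) =
        fun ω => ((fun r : Fin t => X ω r), ω.1 0) from
      funext fun ω => Prod.ext (funext fun r => hlast ω t r) rfl] at h
    exact h
  set Φ : (ℕ → Fin B → ℝ) × ℝ → ℝ := fun q =>
    D.U (fun t => A.act t fun r : Fin (t + 1) => q.1 r) q.2 with hΦ
  have hact : Measurable fun q : (ℕ → Fin B → ℝ) × ℝ =>
      ((fun t => A.act t fun r : Fin (t + 1) => q.1 r, q.2) : ((t : ℕ) → D.Act t) × ℝ) :=
    (measurable_pi_iff.2 fun t => (A.measurable_act t).comp (by fun_prop)).prodMk measurable_snd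
  have hΦm : Measurable Φ := D.measurable_U.comp hact
  have hpay : E.payoff D S A = fun ω => Φ (X ω, ω.1 0) := by
    ext ω
    rw [payoff, hΦ]
    congr 1
    ext t : 1
    congr 1
    exact funext fun r => hlast ω (t + 1) r
  -- For a frozen seed `u` the simulated history is a measurable function of the actual one, so this
  -- is a genuine nonrandomized strategy.
  set A' : (ℕ → I) → DecisionStrategy D B := fun u =>
    { act := fun t h => A.act t (G (t + 1) h u)
      measurable_act := fun t => (A.measurable_act t).comp
        ((hG (t + 1)).comp measurable_prodMk_right) } with hA'
  have hpay' : ∀ u, E.payoff D S' (A' u) = fun ω => Φ (Y (ω, u), ω.1 0) := by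
    intro u
    ext ω
    rw [payoff, hΦ]
    congr 1
    ext t : 1
    refine congrArg (A.act t) ?_
    exact funext fun r => hGlast ω u (t + 1) r
  have hYTm : Measurable fun p : Sample K × (ℕ → I) => (Y p, p.1.1 0) := by fun_prop
  have hXTm : Measurable fun ω : Sample K => (X ω, ω.1 0) := by fun_prop
  have hint : Integrable (fun p : Sample K × (ℕ → I) => Φ (Y p, p.1.1 0))
      (E.P.prod unifSeq) := by
    have h : Integrable Φ (E.P.map fun ω => (X ω, ω.1 0)) := by
      rw [integrable_map_measure hΦm.aestronglyMeasurable hXTm.aemeasurable]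
      rw [FinitePayoff, hpay] at hA
      exact hA
    rw [← heq, integrable_map_measure hΦm.aestronglyMeasurable hYTm.aemeasurable] at h
    exact h
  have hval : E.expectedPayoff D S A = ∫ u, ∫ ω, Φ (Y (ω, u), ω.1 0) ∂E.P ∂unifSeq := by
    rw [← integral_prod_symm (fun p : Sample K × (ℕ → I) => Φ (Y p, p.1.1 0)) hint,
      expectedPayoff, hpay,
      ← integral_map (f := Φ) hXTm.aemeasurable hΦm.aestronglyMeasurable, ← heq,
      integral_map hYTm.aemeasurable hΦm.aestronglyMeasurable]
  -- Some seed attains at least the average payoff, and it can be chosen outside the null set of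
  -- seeds with a nonintegrable payoff.
  obtain ⟨u, hu, hle⟩ := exists_notMem_null_integral_le hint.integral_prod_right
    (measure_eq_zero_iff_ae_notMem.2 (hint.prod_left_ae.mono fun u hu => not_not.2 hu))
  refine ⟨A' u, ?_, ?_⟩
  · rw [FinitePayoff, hpay']
    exact not_not.1 hu
  · rw [hval, expectedPayoff, hpay']
    exact hle

variable (hw : ∀ θ : EuclideanSpace ℝ (Fin K), θ 0 = ∑ k, E.transformedState k θ)
include hw

lemma abs_sub_le_of_isOptimalDivision {t : ℕ} {n : Fin K → ℕ} (hn : E.IsOptimalDivision t n)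
    (ht : 8 * (E.R + 1) * (K : ℝ) * √(K : ℝ) ≤ (t : ℝ)) (i : Fin K) :
    |(n i : ℝ) - (t : ℝ) / (K : ℝ)| ≤ 4 * (E.R + 1) * √(K : ℝ) := by
  refine abs_sub_le_of_isMin E.transformedCov_posDef.inv hn.1 (fun q hq => ?_) ht i
  have h := hn.2 q hq
  rwa [E.postVar_eq_stateVar hw, E.postVar_eq_stateVar hw] at h

/-- For a large block size, some optimal divisions for whole numbers of blocks are increasing. -/
lemma exists_monotone_isOptimalDivision
    (hB : 8 * (E.R + 1) * (K : ℝ) * √(K : ℝ) ≤ (B : ℝ)) :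
    ∃ n : ℕ → Fin K → ℕ, (∀ t, E.IsOptimalDivision (t * B) (n t)) ∧ ∀ t k, n t k ≤ n (t + 1) k := by
  choose n hn using fun t => exists_sum_eq_isMin E.postVar (t * B)
  refine ⟨n, hn, fun t k => ?_⟩
  have hK : (0 : ℝ) < K := Nat.cast_pos.2 (NeZero.pos K)
  have hR : 0 ≤ E.R := norm_nonneg _
  -- The bound of part (b) is not available at `t = 0`, but there the division is zero.
  rcases Nat.eq_zero_or_pos t with rfl | ht
  · have h : n 0 k ≤ ∑ k, n 0 k := Finset.single_le_sum (fun _ _ => Nat.zero_le _)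
      (Finset.mem_univ k)
    rw [(hn 0).1] at h
    omega
  · have hlarge : ∀ t : ℕ, 0 < t → 8 * (E.R + 1) * (K : ℝ) * √(K : ℝ) ≤ ((t * B : ℕ) : ℝ) :=
      fun t ht => hB.trans (by exact_mod_cast Nat.le_mul_of_pos_left B ht)
    have h1 := E.abs_sub_le_of_isOptimalDivision hw (hn t) (hlarge t ht) k
    have h2 := E.abs_sub_le_of_isOptimalDivision hw (hn (t + 1)) (hlarge _ t.succ_pos) k
    have h3 : ((((t + 1) * B : ℕ) : ℝ)) / K = ((t * B : ℕ) : ℝ) / K + B / K := by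
      push_cast
      ring
    have h4 : 8 * (E.R + 1) * √(K : ℝ) ≤ B / K := by
      rw [le_div_iff₀ hK]
      linarith
    rw [abs_le] at h1 h2
    have : (n t k : ℝ) ≤ n (t + 1) k := by linarith
    exact_mod_cast this

/-- The fixed strategy observes the increments of an increasing sequence of optimal divisions. It is
myopic because each division is optimal among all of its size, in particular among those that extend
the previous one. -/
theorem myopicIsOptimal (hB : 8 * (E.R + 1) * (K : ℝ) * √(K : ℝ) ≤ (B : ℝ)) :
    MyopicIsOptimal.{u} E B := by
  obtain ⟨n, hopt, hmono⟩ := E.exists_monotone_isOptimalDivision hw hB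
  have h0 : n 0 = 0 := by
    have h := (hopt 0).1
    rw [zero_mul, Finset.sum_eq_zero_iff] at h
    exact funext fun k => h k (Finset.mem_univ k)
  choose c hc using fun t => exists_tally_eq (B := B) (fun k => n (t + 1) k - n t k) (by
    have h1 := (hopt t).1
    have h2 := (hopt (t + 1)).1
    have h3 : ∑ k, (n (t + 1) k - n t k) + ∑ k, n t k = ∑ k, n (t + 1) k := by
      rw [← Finset.sum_add_distrib]
      exact Finset.sum_congr rfl fun k _ => Nat.sub_add_cancel (hmono t k)
    rw [h1, h2, Nat.succ_mul] at h3
    omega)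
  have hstep : ∀ t, n (t + 1) = n t + tally (c t) := fun t => by
    ext k
    rw [hc, Pi.add_apply, Nat.add_sub_cancel' (hmono t k)]
  have hdiv : ∀ {t : ℕ} (h : History B t), (fixedStrategy c).division h = n t :=
    fun h => division_fixedStrategy h0 hstep h
  have hdom : ∀ (D : DecisionProblem.{u}) (S : InfoStrategy K B) (A : DecisionStrategy D B),
      E.FinitePayoff D S A → ∃ A' : DecisionStrategy D B,
        E.FinitePayoff D (fixedStrategy c) A' ∧
          E.expectedPayoff D S A ≤ E.expectedPayoff D (fixedStrategy c) A' := by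
    intro D S A hA
    obtain ⟨G, hG, hGs, hlaw⟩ := E.exists_simulation hw S (fixedStrategy c)
      (v := fun t => E.stateVar (n t)) (fun t h => by rw [histVar, hdiv])
      (fun t h => by rw [nextVar, hdiv, hstep]; rfl)
      (fun t q hq => by
        rw [← E.postVar_eq_stateVar hw, ← E.postVar_eq_stateVar hw]
        exact (hopt t).2 q hq)
    exact E.exists_payoff_ge_of_simulation hG hGs hlaw D A hA
  refine ⟨fixedStrategy c, fun t h d => ?_, fun D => ⟨hdom D, ?_⟩⟩
  · rw [hdiv, show tally ((fixedStrategy c).choose t h) = tally (c t) from rfl, ← hstep]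
    refine (hopt (t + 1)).2 _ ?_
    simp only [Pi.add_apply, Finset.sum_add_distrib, sum_tally, (hopt t).1]
    ring
  · rintro ⟨S, A, hfin, hbest⟩
    obtain ⟨A', hfin', hle⟩ := hdom D S A hfin
    exact ⟨A', hfin', fun S₁ A₁ h₁ => (hbest S₁ A₁ h₁).trans hle⟩

end Environment

end Acquisition

end

theorem proposition1 {K : ℕ} [NeZero K] (E : Acquisition.Environment K)
    (hw : ∀ θ : EuclideanSpace ℝ (Fin K), θ 0 = ∑ k, E.transformedState k θ) :
    (∀ B : ℕ, 8 * (E.R + 1) * (K : ℝ) ^ (1.5 : ℝ) ≤ (B : ℝ) →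
      Acquisition.Environment.MyopicIsOptimal.{u} E B) ∧
    (∀ (t : ℕ) (n : Fin K → ℕ), E.IsOptimalDivision t n →
      8 * (E.R + 1) * (K : ℝ) * √(K : ℝ) ≤ (t : ℝ) →
      ∀ i, |(n i : ℝ) - (t : ℝ) / (K : ℝ)| ≤ 4 * (E.R + 1) * √(K : ℝ)) := by
  refine ⟨fun B hB => E.myopicIsOptimal hw ?_,
    fun t n hn ht i => E.abs_sub_le_of_isOptimalDivision hw hn ht i⟩
  have hK : (0 : ℝ) < K := Nat.cast_pos.2 (NeZero.pos K)
  have h : (K : ℝ) ^ (1.5 : ℝ) = K * √(K : ℝ) := by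
    rw [Real.sqrt_eq_rpow, show (1.5 : ℝ) = 1 + 1 / 2 by norm_num, Real.rpow_add hK,
      Real.rpow_one]
  rwa [h, ← mul_assoc] at hB
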